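/- Let $k$ be a field of characteristic $0$ with algebraic closure $\bar k$, let $d\ge 3$, and let $f_{d-1}, f_d\in k[x_1,x_2,x_3]$ be nonzero homogeneous polynomials of degrees $d-1$ and $d$ with $\gcd(f_{d-1},f_d)=1$, such that the plane curves $Z(f_{d-1})$ and $Z(f_d)$ in $\mathbb P^2=\mathbb P^2_{\bar k}$ have no common singular point (a point of a hypersurface $Z(h)$ is called singular if $h$ and all its partial derivatives vanish there). Put $F=x_0f_{d-1}+f_d$, so that $Z(F)\subset\mathbb P^3=\mathbb P^3_{\bar k}$ is a normalized non-degenerate monoid surface, and let $O=(1:0:0:0)$. For $b=(b_1:b_2:b_3)\in\mathbb P^2$ let $L_b=\{(s:tb_1:tb_2:tb_3) : (s:t)\in\mathbb P^1\}$, and let $$I_b(f_{d-1},f_d)=\operatorname{length}\,\frac{\bar k[x_1,x_2,x_3]_{m_b}}{(f_{d-1},f_d)},\qquad m_b=(b_2x_1-b_1x_2,\ b_3x_1-b_1x_3,\ b_3x_2-b_2x_3),$$ where the length is that of the quotient ring as a module over itself. Let $P\neq O$ be a singular point of $Z(F)$. Then $P$ lies on $L_b$ for some base point $b$, that is, some $b\in\mathbb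 P^2$ with $f_{d-1}(b)=f_d(b)=0$. Moreover, for the point $b$ with $P\in L_b$, the number $m=I_b(f_{d-1},f_d)$ is finite, $m\ge 2$, and $P$ is an $A_{m-1}$ singularity of $Z(F)$: in each standard affine chart containing $P$, the local equation of $Z(F)$ in coordinates $y_1,y_2,y_3$ centred at $P$ is carried to $y_1^2+y_2^2+y_3^{m}$ by an automorphism of the $\bar k$-algebra $\bar k[[y_1,y_2,y_3]]$. The Milnor number of $Z(F)$ at $P$, that is, the dimension over $\bar k$ of $\bar k[y_1,y_2,y_3]_{(y_1,y_2,y_3)}$ modulo the partial derivatives of such a local equation, equals $m-1$. -/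

import Mathlib

open scoped LinearAlgebra.Projectivization

namespace MonoidSurface

open MvPolynomial

noncomputable section

/-- The quaternary form `F = x₀ f + g`, where `f` and `g` are forms in `x₁, x₂, x₃`
(the variable of index `j` of `f` and `g` becomes the variable of index `j + 1`). -/
def monoidForm {k : Type*} [CommRing k] (f g : MvPolynomial (Fin 3) k) :
    MvPolynomial (Fin 4) k :=
  X 0 * rename Fin.succ f + rename Fin.succ g

/-- `P` is a point of the hypersurface `Z(F)` of projective space, for a form `F`.
(For a form, the condition does not depend on the representative of `P`.) -/
def IsZero {K : Type*} [Field K] {n : ℕ} (F : MvPolynomial (Fin n) K)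
    (P : ℙ K (Fin n → K)) : Prop :=
  eval P.rep F = 0

/-- `P` is a singular point of the hypersurface `Z(F)`, for a form `F`: the form and all its
partial derivatives vanish at `P`. -/
def IsSingularPoint {K : Type*} [Field K] {n : ℕ} (F : MvPolynomial (Fin n) K)
    (P : ℙ K (Fin n → K)) : Prop :=
  IsZero F P ∧ ∀ i, eval P.rep (pderiv i F) = 0

/-- `f` (of degree `d - 1`) and `g` (of degree `d`) define a normalized non-degenerate monoid
surface `Z(x₀ f + g)`. The points of the two plane curves are the points with coordinates in
the algebraic closure `K` of `k`. -/
structure IsNormalizedNondegenerate {k : Type*} (K : Type*) [Field k] [Field K] [Algebra k K]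
    (d : ℕ) (f g : MvPolynomial (Fin 3) k) : Prop where
  three_le : 3 ≤ d
  isHomogeneous_left : f.IsHomogeneous (d - 1)
  isHomogeneous_right : g.IsHomogeneous d
  ne_zero_left : f ≠ 0
  ne_zero_right : g ≠ 0
  isRelPrime : IsRelPrime f g
  no_common_singular_point : ∀ a : ℙ K (Fin 3 → K),
    ¬ (IsSingularPoint (map (algebraMap k K) f) a ∧
       IsSingularPoint (map (algebraMap k K) g) a)

/-- The point `O = (1 : 0 : 0 : 0)`. -/
def pointO (K : Type*) [Field K] : ℙ K (Fin 4 → K) :=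
  Projectivization.mk K (Pi.single 0 1) (by simp)

/-- The line `L_b = {(s : t b₁ : t b₂ : t b₃)}` through `O`, for a point `b` of the plane. -/
def line {K : Type*} [Field K] (b : ℙ K (Fin 3 → K)) : Set (ℙ K (Fin 4 → K)) :=
  {P | ∃ (s t : K) (h : (Fin.cons s (t • b.rep) : Fin 4 → K) ≠ 0), P = Projectivization.mk K _ h}

/-! ### Local intersection numbers -/

/-- The homogeneous ideal of the point `(p₁ : p₂ : p₃)`, as the ideal of the polynomials that
vanish on the generic point `(p₁ t, p₂ t, p₃ t)` of the line spanned by `p`. By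
`pointIdeal_eq_span` it is generated by the linear forms `p_j x_i - p_i x_j`. -/
def pointIdeal {K : Type*} [Field K] (p : Fin 3 → K) : Ideal (MvPolynomial (Fin 3) K) :=
  RingHom.ker (aeval (fun i => Polynomial.C (p i) * Polynomial.X) :
    MvPolynomial (Fin 3) K →ₐ[K] Polynomial K)

instance {K : Type*} [Field K] (p : Fin 3 → K) : (pointIdeal p).IsPrime :=
  RingHom.ker_isPrime _

theorem pointIdeal_eq_span {K : Type*} [Field K] (p : Fin 3 → K) (hp : p ≠ 0) :
    pointIdeal p =
      Ideal.span (Set.range fun ij : Fin 3 × Fin 3 => C (p ij.2) * X ij.1 - C (p ij.1) * X ij.2) := by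
  set I : Ideal (MvPolynomial (Fin 3) K) :=
    Ideal.span (Set.range fun ij : Fin 3 × Fin 3 => C (p ij.2) * X ij.1 - C (p ij.1) * X ij.2)
    with hI
  apply le_antisymm
  · obtain ⟨j, hj⟩ := Function.ne_iff.mp hp
    replace hj : p j ≠ 0 := hj
    let ψ : Polynomial K →ₐ[K] MvPolynomial (Fin 3) K ⧸ I :=
      Polynomial.aeval (Ideal.Quotient.mk I (C (p j)⁻¹ * X j))
    have key : ψ.comp (aeval (fun i => Polynomial.C (p i) * Polynomial.X)) =
        Ideal.Quotient.mkₐ K I := by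
      apply MvPolynomial.algHom_ext
      intro i
      have h1 : Ideal.Quotient.mk I (C (p i) * (C (p j)⁻¹ * X j)) = Ideal.Quotient.mk I (X i) := by
        rw [Ideal.Quotient.eq]
        have h2 : C (p j) * X i - C (p i) * X j ∈ I := Ideal.subset_span ⟨(i, j), rfl⟩
        have h3 := I.mul_mem_left (-(C (p j)⁻¹)) h2
        have h4 : (C (p j)⁻¹ : MvPolynomial (Fin 3) K) * C (p j) = 1 := by
          rw [← C_mul, inv_mul_cancel₀ hj, C_1]
        convert h3 using 1
        linear_combination (X i : MvPolynomial (Fin 3) K) * h4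
      have h5 : ψ (Polynomial.C (p i)) = Ideal.Quotient.mk I (C (p i)) := by
        simp only [ψ, Polynomial.aeval_C]
        rfl
      have h6 : ψ Polynomial.X = Ideal.Quotient.mk I (C (p j)⁻¹ * X j) := by
        simp only [ψ, Polynomial.aeval_X]
      rw [AlgHom.comp_apply, aeval_X, map_mul, h5, h6, ← map_mul, h1]
      rfl
    intro q hq
    have hq' : aeval (fun i => Polynomial.C (p i) * Polynomial.X) q = (0 : Polynomial K) := hq
    have := DFunLike.congr_fun key q
    rw [AlgHom.comp_apply, hq', map_zero] at this
    exact Ideal.Quotient.eq_zero_iff_mem.mp this.symm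
  · rw [hI, Ideal.span_le]
    rintro _ ⟨⟨i, j⟩, rfl⟩
    change aeval (fun i => Polynomial.C (p i) * Polynomial.X) _ = (0 : Polynomial K)
    simp only [map_sub, map_mul, aeval_X, aeval_C, Polynomial.algebraMap_eq]
    ring

/-- The local intersection number `I_b(f, g)`: the length, as a module over itself, of the
quotient of `K[x₁, x₂, x₃]` localized at the homogeneous ideal of `b`, by the ideal `(f, g)`. -/
def intersectionNumber {K : Type*} [Field K] (b : ℙ K (Fin 3 → K))
    (f g : MvPolynomial (Fin 3) K) : ℕ∞ :=
  let R := Localization.AtPrime (pointIdeal b.rep)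
  let Q := R ⧸ Ideal.span {algebraMap (MvPolynomial (Fin 3) K) R f,
    algebraMap (MvPolynomial (Fin 3) K) R g}
  Module.length Q Q

/-! ### Surface singularities -/

/-- The equation of `Z(F)` in the affine chart `x_i = 1`, in the affine coordinates centred
at `P`. It is meaningful when the coordinate of index `i` of `P` is nonzero. -/
def localEquation {K : Type*} [Field K] (F : MvPolynomial (Fin 4) K) (P : ℙ K (Fin 4 → K))
    (i : Fin 4) : MvPolynomial (Fin 3) K :=
  aeval (i.insertNth (α := fun _ => MvPolynomial (Fin 3) K) 1
    (fun j => X j + C (P.rep (i.succAbove j) / P.rep i))) F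

/-- Formal right equivalence: the power series `g` and `h` differ by an automorphism of the
`K`-algebra `K⟦y₁, y₂, y₃⟧`, that is, by a formal change of coordinates. -/
def RightEquivalent {K : Type*} [Field K] (g h : MvPowerSeries (Fin 3) K) : Prop :=
  ∃ φ : MvPowerSeries (Fin 3) K ≃ₐ[K] MvPowerSeries (Fin 3) K, φ g = h

/-- The normal form `y₁² + y₂² + y₃ⁿ⁺¹` of an `Aₙ` surface singularity. -/
def normalFormA (K : Type*) [Field K] (n : ℕ) : MvPolynomial (Fin 3) K :=
  X 0 ^ 2 + X 1 ^ 2 + X 2 ^ (n + 1)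

/-- `P` is an `Aₙ` singularity of the surface `Z(F)`: in every standard affine chart that
contains `P`, the local equation at `P` is right equivalent to the normal form. -/
def IsASingularity {K : Type*} [Field K] (n : ℕ) (F : MvPolynomial (Fin 4) K)
    (P : ℙ K (Fin 4 → K)) : Prop :=
  ∀ i : Fin 4, P.rep i ≠ 0 →
    RightEquivalent (localEquation F P i : MvPowerSeries (Fin 3) K)
      (normalFormA K n : MvPowerSeries (Fin 3) K)

/-- The ideal `(y₁, y₂, y₃)` of the origin: the polynomials that vanish there. -/
def originIdeal (K : Type*) [Field K] : Ideal (MvPolynomial (Fin 3) K) :=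
  RingHom.ker (eval (0 : Fin 3 → K))

instance (K : Type*) [Field K] : (originIdeal K).IsPrime :=
  RingHom.ker_isPrime _

/-- The Milnor number of `g` at the origin: the dimension over `K` of the quotient of
`K[y₁, y₂, y₃]` localized at the origin by the ideal of the three partial derivatives of `g`. -/
def milnorNumber {K : Type*} [Field K] (g : MvPolynomial (Fin 3) K) : ℕ∞ :=
  let R := Localization.AtPrime (originIdeal K)
  Cardinal.toENat (Module.rank K (R ⧸ Ideal.span (Set.range fun i : Fin 3 =>
    algebraMap (MvPolynomial (Fin 3) K) R (pderiv i g))))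

/-- The surface `Z(F)` has Milnor number `μ` at `P`, computed in any standard affine chart
that contains `P`. -/
def HasMilnorNumber {K : Type*} [Field K] (F : MvPolynomial (Fin 4) K) (P : ℙ K (Fin 4 → K))
    (μ : ℕ∞) : Prop :=
  ∀ i : Fin 4, P.rep i ≠ 0 → milnorNumber (localEquation F P i) = μ

end

end MonoidSurface

/-!
Let `P ≠ O` be a singular point of `F = x₀ f + g`, and write `P = (P₀ : p)`. The derivative by `x₀`
gives `f(p) = 0`, whence `g(p) = 0`, and the others give `∇g(p) = -P₀ ∇f(p)`; so `∇f(p) ≠ 0`, as `p`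
is not singular on both curves. For a suitable linear form `κ xⱼ`, the form `x₀ - κ xⱼ` vanishes
at `P`, and `F = (x₀ - κ xⱼ) f + h` with `h = g + κ xⱼ f` singular at `p`.

The local ring of the curve `f` at the smooth point `p` has its maximal ideal generated by a linear
form `c` transverse to `f` (`maximalIdeal_pointLocalRing`). As `f` and `g` are coprime, `h` is not
zero there, so it is a unit times `cᵐ`: there is a polynomial relation `s h = a f + u cᵐ` with `s`
and `u` invertible at `p`, and gradients show `m ≥ 2` and `a(p) = 0` (`exists_relation`). Since
`(f, g) = (f, h) = (f, cᵐ)` locally, `m` is the intersection number (`intersectionNumber_eq`).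

Multiplying `F` by `s` gives `s F = (s (x₀ - κ xⱼ) + a) f + u cᵐ`, and in every chart at `P` the
three functions `f`, `s (x₀ - κ xⱼ) + a` and `c` are local coordinates
(`isLocalCoordinates_monoid`). So the local equation has the shape `A B + w Cᵐ`, up to a unit, in
local coordinates `A`, `B`, `C`. The formal inverse function theorem
(`MvPowerSeries.exists_algEquiv_X`) and `m`-th roots of units bring it to the normal form
(`rightEquivalent_normalFormA`). Its Jacobian ideal is `(A, B, Cᵐ⁻¹)`, by Nakayama's lemma, which
gives the Milnor number (`milnorNumber_eq_sub_one`). Both the length and the dimension are computed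
by `IsLocalRing.length_quotient_sup_span_pow`; that no power of `c` lies in the ideal of the next
one is read off in formal coordinates.
-/

/-! ### The formal inverse function theorem -/

namespace MvPowerSeries

variable {σ R : Type*} [CommRing R]

/-- If `a i` agrees with the variable `X i` to first order, a monomial in the `a i` has the
corresponding monomial in the variables as its initial form. -/
theorem succ_degree_le_order_prod_pow_sub [Nontrivial R] {a : σ → MvPowerSeries σ R}
    (ha : ∀ i, 2 ≤ (a i - X i).order) (e : σ →₀ ℕ) :
    (e.degree + 1 : ℕ∞) ≤ (e.prod (fun i n => a i ^ n) - monomial e 1).order := by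
  classical
  induction e using Finsupp.induction_linear with
  | zero => simp
  | add e₁ e₂ h₁ h₂ =>
    have key : (e₁ + e₂).prod (fun i n => a i ^ n) - monomial (e₁ + e₂) (1 : R) =
        (e₁.prod (fun i n => a i ^ n) - monomial e₁ 1) *
          (e₂.prod (fun i n => a i ^ n) - monomial e₂ 1) +
        ((e₁.prod (fun i n => a i ^ n) - monomial e₁ 1) * monomial e₂ 1 +
        monomial e₁ 1 * (e₂.prod (fun i n => a i ^ n) - monomial e₂ 1)) := by
      rw [Finsupp.prod_add_index' (by simp) (by intros; rw [pow_add])]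
      have : monomial (e₁ + e₂) (1 : R) = monomial e₁ 1 * monomial e₂ 1 := by
        rw [monomial_mul_monomial, one_mul]
      rw [this]; ring
    rw [key, map_add, Nat.cast_add]
    have o₁ : (monomial e₁ (1 : R)).order = e₁.degree := order_monomial_of_ne_zero one_ne_zero
    have o₂ : (monomial e₂ (1 : R)).order = e₂.degree := order_monomial_of_ne_zero one_ne_zero
    refine le_trans (le_min ?_ (le_trans (le_min ?_ ?_) (min_order_le_add ..)))
      (min_order_le_add ..)
    · refine le_trans ?_ le_order_mul
      refine le_trans ?_ (add_le_add h₁ h₂)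
      exact_mod_cast (by omega : e₁.degree + e₂.degree + 1 ≤ (e₁.degree + 1) + (e₂.degree + 1))
    · refine le_trans ?_ le_order_mul
      rw [o₂]
      refine le_trans ?_ (add_le_add h₁ le_rfl)
      exact_mod_cast (by omega : e₁.degree + e₂.degree + 1 ≤ (e₁.degree + 1) + e₂.degree)
    · refine le_trans ?_ le_order_mul
      rw [o₁]
      refine le_trans ?_ (add_le_add le_rfl h₂)
      exact_mod_cast (by omega : e₁.degree + e₂.degree + 1 ≤ e₁.degree + (e₂.degree + 1))
  | single i n =>
    rw [Finsupp.prod_single_index (by simp), Finsupp.degree_single]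
    induction n with
    | zero => simp
    | succ n ih =>
      have key : a i ^ (n + 1) - monomial (Finsupp.single i (n + 1)) (1 : R) =
          (a i ^ n - monomial (Finsupp.single i n) 1) * (a i - X i) +
          ((a i ^ n - monomial (Finsupp.single i n) 1) * X i +
          monomial (Finsupp.single i n) 1 * (a i - X i)) := by
        have : monomial (Finsupp.single i (n + 1)) (1 : R) =
            monomial (Finsupp.single i n) 1 * X i := by
          rw [X, monomial_mul_monomial, one_mul, Finsupp.single_add]
        rw [this]; ring
      have o₁ : (monomial (Finsupp.single i n) (1 : R)).order = n := by
        rw [order_monomial_of_ne_zero one_ne_zero, Finsupp.degree_single]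
      have o₂ : (X i : MvPowerSeries σ R).order = 1 := by
        rw [X, order_monomial_of_ne_zero one_ne_zero, Finsupp.degree_single, Nat.cast_one]
      rw [key]
      have h2 := ha i
      refine le_trans (le_min ?_ (le_trans (le_min ?_ ?_) (min_order_le_add ..)))
        (min_order_le_add ..)
      · refine le_trans ?_ le_order_mul
        refine le_trans ?_ (add_le_add ih h2)
        exact_mod_cast (by omega : n + 1 + 1 ≤ (n + 1) + 2)
      · refine le_trans ?_ le_order_mul
        rw [o₂]
        refine le_trans ?_ (add_le_add ih le_rfl)
        exact_mod_cast le_rfl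
      · refine le_trans ?_ le_order_mul
        rw [o₁]
        refine le_trans ?_ (add_le_add le_rfl h2)
        exact_mod_cast le_rfl

theorem hasSubst_of_two_le_order_sub [Finite σ] {a : σ → MvPowerSeries σ R}
    (ha : ∀ i, 2 ≤ (a i - X i).order) : HasSubst a := by
  refine hasSubst_of_constantCoeff_zero fun i => ?_
  have h : coeff 0 (a i - X i) = 0 := coeff_of_lt_order (by
    rw [map_zero]; exact lt_of_lt_of_le (by norm_num) (ha i))
  simpa using h

theorem succ_le_order_subst_sub [Finite σ] [Nontrivial R] {a : σ → MvPowerSeries σ R}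
    (ha : ∀ i, 2 ≤ (a i - X i).order) {p : MvPowerSeries σ R} {k : ℕ} (hp : k ≤ p.order) :
    ((k + 1 : ℕ) : ℕ∞) ≤ (subst a p - p).order := by
  classical
  refine nat_le_order fun e he => ?_
  rw [map_sub, coeff_subst (hasSubst_of_two_le_order_sub ha), sub_eq_zero]
  have key : ∀ d, coeff d p • coeff e (d.prod fun i n => a i ^ n) =
      if d = e then coeff e p else 0 := by
    intro d
    by_cases hd : d.degree < k
    · have h0 : coeff d p = 0 := coeff_of_lt_order (lt_of_lt_of_le (by exact_mod_cast hd) hp)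
      rw [h0, zero_smul]
      split_ifs with h
      · rw [← h, h0]
      · rfl
    · have h1 : coeff e (d.prod (fun i n => a i ^ n) - monomial d 1) = 0 :=
        coeff_of_lt_order (lt_of_lt_of_le (by exact_mod_cast (by omega : e.degree < d.degree + 1))
          (succ_degree_le_order_prod_pow_sub ha d))
      rw [map_sub, sub_eq_zero, coeff_monomial] at h1
      rw [h1]
      by_cases h : d = e
      · simp [h]
      · rw [if_neg h, if_neg (Ne.symm h), smul_zero]
  rw [finsum_congr key, finsum_eq_single _ e (fun d hd => if_neg hd), if_pos rfl]

/-- A substitution tangent to the identity is bijective: `subst a - id` raises the order, so the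
iteration `p ↦ q - (subst a p - p)` converges to the preimage of `q`. -/
theorem subst_bijective_of_two_le_order_sub [Finite σ] [Nontrivial R] {a : σ → MvPowerSeries σ R}
    (ha : ∀ i, 2 ≤ (a i - X i).order) :
    Function.Bijective (subst a : MvPowerSeries σ R → MvPowerSeries σ R) := by
  have hs := hasSubst_of_two_le_order_sub ha
  have hzero : ∀ p : MvPowerSeries σ R, subst a p = 0 → p = 0 := by
    intro p hp
    by_contra hne
    have h := succ_le_order_subst_sub ha (p := p) (k := p.order.toNat)
      (le_of_eq (ne_zero_iff_order_finite.mp hne))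
    rw [hp, zero_sub, order_neg, ← ne_zero_iff_order_finite.mp hne] at h
    simp only [ENat.toNat_natCast] at h
    exact absurd (by exact_mod_cast h) (Nat.not_succ_le_self p.order.toNat)
  constructor
  · intro p q hpq
    exact sub_eq_zero.mp (hzero _ (by rw [subst_sub hs, hpq, sub_self]))
  · intro q
    -- the iterates `u n` are Cauchy for the order, and `p` is their limit
    let u : ℕ → MvPowerSeries σ R := fun n => Nat.rec q (fun _ p => q - (subst a p - p)) n
    have hu : ∀ n, u (n + 1) = q - (subst a (u n) - u n) := fun n => rfl
    have hstep : ∀ n : ℕ, (n : ℕ∞) ≤ (u (n + 1) - u n).order := by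
      intro n
      induction n with
      | zero => simp
      | succ n ih =>
        have h := succ_le_order_subst_sub ha ih
        have h2 : u (n + 1 + 1) - u (n + 1) =
            -(subst a (u (n + 1) - u n) - (u (n + 1) - u n)) := by
          rw [subst_sub hs]
          linear_combination hu (n + 1) - hu n
        rw [h2, order_neg]
        exact h
    have hcauchy : ∀ n j : ℕ, (n : ℕ∞) ≤ (u (n + j) - u n).order := by
      intro n j
      induction j with
      | zero => simp
      | succ j ih =>
        have : u (n + (j + 1)) - u n = (u (n + j + 1) - u (n + j)) + (u (n + j) - u n) := by
          rw [← add_assoc]; ring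
        rw [this]
        refine le_trans (le_min ?_ ih) (min_order_le_add ..)
        exact le_trans (by exact_mod_cast Nat.le_add_right n j) (hstep (n + j))
    let p : MvPowerSeries σ R := fun e => coeff e (u (e.degree + 1))
    have hpc : ∀ e, coeff e p = coeff e (u (e.degree + 1)) := fun e => rfl
    have hp : ∀ n : ℕ, (n : ℕ∞) ≤ (p - u n).order := by
      intro n
      refine nat_le_order fun e he => ?_
      obtain ⟨j, rfl⟩ := Nat.exists_eq_add_of_lt he
      have := hcauchy (e.degree + 1) j
      have h0 : coeff e (u (e.degree + 1 + j) - u (e.degree + 1)) = 0 :=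
        coeff_of_lt_order (lt_of_lt_of_le (by exact_mod_cast Nat.lt_succ_self _) this)
      rw [map_sub, hpc, ← neg_sub, ← map_sub, add_right_comm, h0, neg_zero]
    refine ⟨p, ?_⟩
    have hall : ∀ n : ℕ, (n : ℕ∞) ≤ (subst a p - q).order := by
      intro n
      have h1 : subst a p - q = (subst a (p - u n) - (p - u n)) + (p - u (n + 1)) := by
        rw [hu, subst_sub hs]; ring
      rw [h1]
      refine le_trans (le_min ?_ ?_) (min_order_le_add ..)
      · exact le_trans (by exact_mod_cast Nat.le_succ n) (succ_le_order_subst_sub ha (hp n))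
      · exact le_trans (by exact_mod_cast Nat.le_succ n) (hp (n + 1))
    have htop : (subst a p - q).order = ⊤ := by
      by_contra hne
      obtain ⟨n, hn⟩ := ENat.ne_top_iff_exists.mp hne
      have := hall (n + 1)
      rw [← hn] at this
      exact absurd (by exact_mod_cast this) (Nat.not_succ_le_self n)
    exact sub_eq_zero.mp (order_eq_top_iff.mp htop)

/-- The linear form whose coefficients are the `i`-th row of the matrix `M`. -/
noncomputable def linearForm [Fintype σ] (M : Matrix σ σ R) (i : σ) : MvPowerSeries σ R :=
  ∑ j, M i j • X j

theorem hasSubst_linearForm [Fintype σ] (M : Matrix σ σ R) : HasSubst (linearForm M) :=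
  hasSubst_of_constantCoeff_zero fun i => by
    simp only [linearForm, map_sum]
    refine Finset.sum_eq_zero fun j _ => ?_
    rw [← coeff_zero_eq_constantCoeff_apply, coeff_smul, coeff_zero_X, mul_zero]

theorem subst_linearForm [Fintype σ] (M : Matrix σ σ R) {a : σ → MvPowerSeries σ R}
    (ha : HasSubst a) (i : σ) : subst a (linearForm M i) = ∑ j, M i j • a j := by
  rw [← substAlgHom_apply ha, linearForm, map_sum]
  refine Finset.sum_congr rfl fun j _ => ?_
  rw [map_smul, substAlgHom_X]

theorem subst_linearForm_linearForm [Fintype σ] [DecidableEq σ] {M N : Matrix σ σ R}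
    (h : M * N = 1) (p : MvPowerSeries σ R) :
    subst (linearForm N) (subst (linearForm M) p) = p := by
  rw [subst_comp_subst_apply (hasSubst_linearForm M) (hasSubst_linearForm N)]
  have : (fun i => subst (linearForm N) (linearForm M i)) = X := by
    funext i
    rw [subst_linearForm M (hasSubst_linearForm N)]
    simp only [linearForm, Finset.smul_sum, smul_smul]
    rw [Finset.sum_comm]
    simp only [← Finset.sum_smul, ← Matrix.mul_apply, h, Matrix.one_apply]
    simp
  rw [this, subst_self, id]

/-- Formal inverse function theorem: power series without constant terms, whose Jacobian matrix
at the origin is invertible, are the images of the variables under an automorphism of the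
power series algebra. -/
theorem exists_algEquiv_X [Fintype σ] [DecidableEq σ] [Nontrivial R] (a : σ → MvPowerSeries σ R)
    (h0 : ∀ i, constantCoeff (a i) = 0)
    (hdet : IsUnit (Matrix.of fun i j => coeff (Finsupp.single j 1) (a i)).det) :
    ∃ φ : MvPowerSeries σ R ≃ₐ[R] MvPowerSeries σ R, ∀ i, φ (X i) = a i := by
  set M : Matrix σ σ R := Matrix.of fun i j => coeff (Finsupp.single j 1) (a i) with hM
  -- `a' = M⁻¹ a` is tangent to the identity, and `a` is its image under the linear substitution.
  let a' : σ → MvPowerSeries σ R := fun i => ∑ j, M⁻¹ i j • a j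
  have hMM : M * M⁻¹ = 1 := M.mul_nonsing_inv hdet
  have hMM' : M⁻¹ * M = 1 := M.nonsing_inv_mul hdet
  have ha' : ∀ i, 2 ≤ (a' i - X i).order := by
    intro i
    refine nat_le_order fun d hd => ?_
    have hd' : d.degree = 0 ∨ d.degree = 1 := by
      have : d.degree < 2 := by exact_mod_cast hd
      omega
    rcases hd' with hd' | hd'
    · have : d = 0 := (Finsupp.degree_eq_zero_iff d).mp hd'
      subst this
      simp [a', h0]
    · obtain ⟨j, rfl⟩ : ∃ j, Finsupp.single j 1 = d := by
        have hmem : d ∈ {d : σ →₀ ℕ | d.degree = 1} := hd'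
        rwa [← Finsupp.range_single_one] at hmem
      have h1 : coeff (Finsupp.single j 1) (a' i) = (M⁻¹ * M) i j := by
        simp only [a', map_sum, Matrix.mul_apply, coeff_smul]
        rfl
      rw [map_sub, h1, hMM', Matrix.one_apply, coeff_X, sub_eq_zero]
      by_cases hij : i = j
      · simp [hij]
      · rw [if_neg hij, if_neg]
        intro h
        exact hij ((Finsupp.single_left_injective one_ne_zero h).symm)
  have hs := hasSubst_of_two_le_order_sub ha'
  let φ₁ : MvPowerSeries σ R ≃ₐ[R] MvPowerSeries σ R :=
    AlgEquiv.ofBijective (substAlgHom hs) (by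
      have := subst_bijective_of_two_le_order_sub ha'
      rwa [← coe_substAlgHom hs] at this)
  let φ₂ : MvPowerSeries σ R ≃ₐ[R] MvPowerSeries σ R :=
    AlgEquiv.ofBijective (substAlgHom (hasSubst_linearForm M)) (by
      rw [coe_substAlgHom]
      exact Function.bijective_iff_has_inverse.mpr ⟨subst (linearForm M⁻¹),
        fun p => subst_linearForm_linearForm hMM p, fun p => subst_linearForm_linearForm hMM' p⟩)
  refine ⟨φ₂.trans φ₁, fun i => ?_⟩
  have e2 : φ₂ (X i) = linearForm M i := substAlgHom_X (hasSubst_linearForm M) i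
  have e1 : φ₁ (linearForm M i) = ∑ j, M i j • a' j := by
    rw [← subst_linearForm M hs, ← substAlgHom_apply hs]; rfl
  rw [AlgEquiv.trans_apply, e2, e1]
  simp only [a', Finset.smul_sum, smul_smul]
  rw [Finset.sum_comm]
  simp only [← Finset.sum_smul, ← Matrix.mul_apply, hMM, Matrix.one_apply]
  simp

end MvPowerSeries

/-! ### Roots of units among power series -/

namespace MvPowerSeries

theorem coeff_single_one_mul {σ R : Type*} [CommRing R] (j : σ) (p q : MvPowerSeries σ R) :
    coeff (Finsupp.single j 1) (p * q) =
      constantCoeff p * coeff (Finsupp.single j 1) q +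
        coeff (Finsupp.single j 1) p * constantCoeff q := by
  classical
  rw [coeff_mul, Finsupp.antidiagonal_single, Finset.sum_map, Finset.Nat.antidiagonal_succ]
  simp

/-- A power series with nonzero constant term over an algebraically closed field of
characteristic zero has an `m`-th root: the binomial series provides a root of `1 + x`. -/
theorem exists_pow_eq {σ K : Type*} [Field K] [CharZero K] [IsAlgClosed K]
    (u : MvPowerSeries σ K) (hu : constantCoeff u ≠ 0) {m : ℕ} (hm : m ≠ 0) :
    ∃ r : MvPowerSeries σ K, r ^ m = u := by
  set c := constantCoeff u with hc
  let x : MvPowerSeries σ K := C c⁻¹ * u - 1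
  have hx : PowerSeries.HasSubst x := PowerSeries.HasSubst.of_constantCoeff_zero (by
    simp [x, ← hc, hu])
  let β : PowerSeries K := PowerSeries.binomialSeries K ((m : ℚ)⁻¹)
  have hβ : β ^ m = 1 + PowerSeries.X := by
    have h1 : ∀ n : ℕ, β ^ n = PowerSeries.binomialSeries K ((n : ℚ) * (m : ℚ)⁻¹) := by
      intro n
      induction n with
      | zero => simp
      | succ n ih =>
        rw [pow_succ, ih, ← PowerSeries.binomialSeries_add]
        congr 1
        push_cast
        ring
    rw [h1, mul_inv_cancel₀ (by exact_mod_cast hm)]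
    have := PowerSeries.binomialSeries_nat (R := ℚ) (A := K) 1
    simpa using this
  obtain ⟨z, hz⟩ := IsAlgClosed.exists_pow_nat_eq c (Nat.pos_of_ne_zero hm)
  refine ⟨C z * PowerSeries.subst x β, ?_⟩
  rw [mul_pow, ← PowerSeries.subst_pow hx, hβ, ← map_pow, hz, ← PowerSeries.coe_substAlgHom hx,
    map_add, map_one, PowerSeries.substAlgHom_X]
  have : (C c * C c⁻¹ : MvPowerSeries σ K) = 1 := by
    rw [← map_mul, mul_inv_cancel₀ hu, map_one]
  simp only [x]
  linear_combination u * this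

end MvPowerSeries

/-! ### Lengths of quotients by powers of a generator -/

/-- If the maximal ideal of the local ring `S` is generated by `c` modulo `I`, and no power of `c`
lies in the next one modulo `I`, then `S ⧸ (I + (cⁿ))` has length `n` over every ring of scalars
over which the residue field has length one. -/
theorem IsLocalRing.length_quotient_sup_span_pow (A : Type*) {S : Type*} [CommRing A] [CommRing S]
    [IsLocalRing S] [Algebra A S]
    (h1 : Module.length A (S ⧸ IsLocalRing.maximalIdeal S) = 1) (I : Ideal S) (c : S)
    (hmax : IsLocalRing.maximalIdeal S = I ⊔ Ideal.span {c})
    (hc : ∀ n, c ^ n ∉ I ⊔ Ideal.span {c ^ (n + 1)}) (n : ℕ) :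
    Module.length A (S ⧸ (I ⊔ Ideal.span {c ^ n})) = n := by
  induction n with
  | zero =>
    have : Subsingleton (S ⧸ (I ⊔ Ideal.span {c ^ 0})) := by
      rw [Ideal.Quotient.subsingleton_iff, pow_zero, Ideal.span_singleton_one, sup_top_eq]
    simp
  | succ n ih =>
    set J := I ⊔ Ideal.span {c ^ n}
    set J' := I ⊔ Ideal.span {c ^ (n + 1)}
    have hJ : J' ≤ J := sup_le_sup le_rfl
      ((Ideal.span_singleton_le_span_singleton).mpr (pow_dvd_pow c (Nat.le_succ n)))
    -- multiplication by `cⁿ` identifies the residue field with the kernel of `S ⧸ J' → S ⧸ J`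
    let ψ : S →ₗ[S] S ⧸ J' := J'.mkQ.comp (LinearMap.mulLeft S (c ^ n))
    have hψ : ∀ x, ψ x = 0 ↔ c ^ n * x ∈ J' := fun x =>
      Submodule.Quotient.mk_eq_zero J'
    have hle : IsLocalRing.maximalIdeal S ≤ LinearMap.ker ψ := by
      rw [hmax]
      refine sup_le (fun x hx => ?_) ?_
      · exact (hψ x).mpr (Ideal.mul_mem_left _ _ (Ideal.mem_sup_left hx))
      · rw [Ideal.span_le, Set.singleton_subset_iff]
        refine (hψ c).mpr (Ideal.mem_sup_right ?_)
        rw [← pow_succ]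
        exact Ideal.mem_span_singleton_self _
    have hker : LinearMap.ker ψ = IsLocalRing.maximalIdeal S := by
      refine ((IsLocalRing.maximalIdeal.isMaximal S).eq_of_le ?_ hle).symm
      intro htop
      have : (1 : S) ∈ LinearMap.ker ψ := by rw [htop]; trivial
      exact hc n (by simpa using (hψ 1).mp this)
    let α : (S ⧸ IsLocalRing.maximalIdeal S) →ₗ[S] S ⧸ J' :=
      (IsLocalRing.maximalIdeal S).liftQ ψ hle
    let β : (S ⧸ J') →ₗ[S] S ⧸ J := Submodule.factor hJ
    have hα : Function.Injective α := by
      rw [← LinearMap.ker_eq_bot]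
      exact Submodule.ker_liftQ_eq_bot _ _ _ hker.le
    have hβ : Function.Surjective β := Submodule.factor_surjective hJ
    have hαβ : Function.Exact α β := by
      intro y
      obtain ⟨y, rfl⟩ := Submodule.mkQ_surjective _ y
      constructor
      · intro hy
        have hy' : y ∈ J := by
          have : (Submodule.Quotient.mk y : S ⧸ J) = 0 := hy
          exact (Submodule.Quotient.mk_eq_zero _).mp this
        obtain ⟨i, hi, z, hz, rfl⟩ := Submodule.mem_sup.mp hy'
        obtain ⟨x, rfl⟩ := Ideal.mem_span_singleton'.mp hz
        refine ⟨Submodule.Quotient.mk x, ?_⟩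
        change (Submodule.Quotient.mk (c ^ n * x) : S ⧸ J') = Submodule.Quotient.mk _
        rw [Submodule.Quotient.eq]
        have : c ^ n * x - (i + x * c ^ n) = -i := by ring
        rw [this]
        exact neg_mem (Ideal.mem_sup_left hi)
      · rintro ⟨x, hx⟩
        obtain ⟨x, rfl⟩ := Submodule.mkQ_surjective _ x
        rw [← hx]
        change (Submodule.Quotient.mk (c ^ n * x) : S ⧸ J) = 0
        rw [Submodule.Quotient.mk_eq_zero]
        exact Ideal.mem_sup_right (Ideal.mul_mem_right _ _ (Ideal.mem_span_singleton_self _))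
    rw [Module.length_eq_add_of_exact (α.restrictScalars A) (β.restrictScalars A) hα hβ hαβ, h1,
      ih]
    push_cast
    rw [add_comm]

/-! ### Formal normal form -/

namespace MonoidSurface

open MvPolynomial

theorem RightEquivalent.trans {K : Type*} [Field K] {g h l : MvPowerSeries (Fin 3) K}
    (h₁ : RightEquivalent g h) (h₂ : RightEquivalent h l) : RightEquivalent g l := by
  obtain ⟨φ, rfl⟩ := h₁
  obtain ⟨ψ, rfl⟩ := h₂
  exact ⟨φ.trans ψ, rfl⟩

theorem RightEquivalent.symm {K : Type*} [Field K] {g h : MvPowerSeries (Fin 3) K}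
    (h₁ : RightEquivalent g h) : RightEquivalent h g := by
  obtain ⟨φ, rfl⟩ := h₁
  exact ⟨φ.symm, φ.symm_apply_apply g⟩

/-- A surface germ with equation `A B + w Cᵐ`, up to a unit `v`, where `A`, `B`, `C` are formal
coordinates and `w` is a unit, is an `A_{m-1}` singularity. -/
theorem rightEquivalent_normalFormA {K : Type*} [Field K] [CharZero K] [IsAlgClosed K]
    {G A B C v w : MvPowerSeries (Fin 3) K} {m : ℕ} (hm : m ≠ 0)
    (hG : v * G = A * B + w * C ^ m)
    (hA : MvPowerSeries.constantCoeff A = 0) (hB : MvPowerSeries.constantCoeff B = 0)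
    (hC : MvPowerSeries.constantCoeff C = 0)
    (hv : MvPowerSeries.constantCoeff v ≠ 0) (hw : MvPowerSeries.constantCoeff w ≠ 0)
    (hdet : (Matrix.of fun i j : Fin 3 =>
      MvPowerSeries.coeff (Finsupp.single j 1) (![A, B, C] i)).det ≠ 0) :
    RightEquivalent G (normalFormA K (m - 1) : MvPowerSeries (Fin 3) K) := by
  have hvi : v⁻¹ * v = 1 := MvPowerSeries.inv_mul_cancel v hv
  have hvi0 : MvPowerSeries.constantCoeff v⁻¹ ≠ 0 := by
    rw [MvPowerSeries.constantCoeff_inv]; exact inv_ne_zero hv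
  obtain ⟨r, hr⟩ := MvPowerSeries.exists_pow_eq (v⁻¹ * w)
    (by rw [map_mul]; exact mul_ne_zero hvi0 hw) hm
  have hr0 : MvPowerSeries.constantCoeff r ≠ 0 := by
    intro h
    have := congrArg MvPowerSeries.constantCoeff hr
    rw [map_pow, h, zero_pow hm, map_mul] at this
    exact mul_ne_zero hvi0 hw this.symm
  -- the formal coordinates `A`, `v⁻¹ B`, `r C` bring `G` to the form `y₁ y₂ + y₃ᵐ`
  obtain ⟨φ, hφ⟩ := MvPowerSeries.exists_algEquiv_X ![A, v⁻¹ * B, r * C]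
    (by intro i; fin_cases i <;> simp [hA, hB, hC])
    (by
      rw [isUnit_iff_ne_zero]
      have : (Matrix.of fun i j : Fin 3 => MvPowerSeries.coeff (Finsupp.single j 1)
          (![A, v⁻¹ * B, r * C] i)).det = MvPowerSeries.constantCoeff v⁻¹ *
            MvPowerSeries.constantCoeff r * (Matrix.of fun i j : Fin 3 =>
          MvPowerSeries.coeff (Finsupp.single j 1) (![A, B, C] i)).det := by
        simp only [Matrix.det_fin_three, Matrix.of_apply, Matrix.cons_val,
          MvPowerSeries.coeff_single_one_mul, hB, hC, mul_zero, add_zero]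
        ring
      rw [this]
      exact mul_ne_zero (mul_ne_zero hvi0 hr0) hdet)
  have hφ0 : φ (MvPowerSeries.X 0) = A := hφ 0
  have hφ1 : φ (MvPowerSeries.X 1) = v⁻¹ * B := hφ 1
  have hφ2 : φ (MvPowerSeries.X 2) = r * C := hφ 2
  obtain ⟨ι, hι⟩ := IsAlgClosed.exists_pow_nat_eq (-1 : K) two_pos
  have hι0 : ι ≠ 0 := by rintro rfl; norm_num at hι
  let X : Fin 3 → MvPowerSeries (Fin 3) K := MvPowerSeries.X
  let c : MvPowerSeries (Fin 3) K := MvPowerSeries.C ι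
  have hc : c ^ 2 = -1 := by rw [← map_pow, hι, map_neg, map_one]
  -- the linear change of coordinates carrying `y₁ y₂` to `y₁² + y₂²`
  obtain ⟨ψ, hψ⟩ := MvPowerSeries.exists_algEquiv_X
    ![X 0 + c * X 1, X 0 - c * X 1, X 2]
    (by intro i; fin_cases i <;> simp [X])
    (by
      have e : ∀ i j : Fin 3, MvPowerSeries.coeff (Finsupp.single j 1) (X i) =
          if j = i then 1 else 0 := by
        intro i j
        simp only [X, MvPowerSeries.coeff_X, Finsupp.single_left_inj one_ne_zero]
      rw [isUnit_iff_ne_zero]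
      simp only [Matrix.det_fin_three, Matrix.of_apply, Matrix.cons_val, map_add, map_sub,
        MvPowerSeries.coeff_single_one_mul, e]
      simp [X, c]
      intro h
      have h2 : (2 : K) * ι = 0 := by linear_combination -h
      exact mul_ne_zero two_ne_zero hι0 h2)
  have hψ0 : ψ (MvPowerSeries.X 0) = X 0 + c * X 1 := hψ 0
  have hψ1 : ψ (MvPowerSeries.X 1) = X 0 - c * X 1 := hψ 1
  have hψ2 : ψ (MvPowerSeries.X 2) = X 2 := hψ 2
  refine RightEquivalent.trans (h := X 0 * X 1 + X 2 ^ m) (RightEquivalent.symm ⟨φ, ?_⟩) ⟨ψ, ?_⟩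
  · rw [map_add, map_mul, map_pow, hφ0, hφ1, hφ2, mul_pow, hr]
    linear_combination v⁻¹ * (-hG) + G * hvi
  · rw [map_add, map_mul, map_pow, hψ0, hψ1, hψ2, normalFormA, Nat.sub_add_cancel (by omega)]
    push_cast
    linear_combination -(X 1) ^ 2 * hc

end MonoidSurface

/-! ### Jacobian ideals in local rings -/

/-- Vectors related by a matrix of unit determinant generate the same ideal. -/
theorem Ideal.span_range_eq_of_mulVec {n S : Type*} [Fintype n] [DecidableEq n] [CommRing S]
    {M : Matrix n n S} (hM : IsUnit M.det) {x y : n → S} (h : y = M.mulVec x) :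
    Ideal.span (Set.range y) = Ideal.span (Set.range x) := by
  have aux : ∀ (N : Matrix n n S) (u : n → S),
      Ideal.span (Set.range (N.mulVec u)) ≤ Ideal.span (Set.range u) := by
    intro N u
    rw [Ideal.span_le]
    rintro _ ⟨i, rfl⟩
    exact Ideal.sum_mem _ fun j _ => Ideal.mul_mem_left _ _ (Ideal.subset_span ⟨j, rfl⟩)
  refine le_antisymm (h ▸ aux M x) ?_
  have := aux M⁻¹ (M.mulVec x)
  rwa [Matrix.mulVec_mulVec, Matrix.nonsing_inv_mul M hM, Matrix.one_mulVec, ← h] at this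

/-- The Jacobian ideal of an element `G` of a local ring with `v G = A B + w Cⁿ⁺¹` for units `v`
and `w`, where `dA`, `dB`, … are the vectors of partial derivatives: modulo the maximal ideal times
`(A, B, Cⁿ)` the partial derivatives are, up to units, an invertible transform of `B`, `A`, `Cⁿ`,
and Nakayama's lemma applies. -/
theorem IsLocalRing.span_range_partials_eq {S : Type*} [CommRing S] [IsLocalRing S]
    {G A B C v w : S} {n : ℕ} {dG dA dB dC dv dw : Fin 3 → S}
    (hA : A ∈ IsLocalRing.maximalIdeal S) (hC : C ∈ IsLocalRing.maximalIdeal S)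
    (hv : IsUnit v) (hw : IsUnit w) (hn : IsUnit ((n + 1 : ℕ) : S))
    (hG : v * G = A * B + w * C ^ (n + 1))
    (hd : ∀ i, v * dG i + G * dv i =
      A * dB i + B * dA i + (w * ((n + 1 : ℕ) * C ^ n * dC i) + C ^ (n + 1) * dw i))
    (hdet : IsUnit (Matrix.of ![dA, dB, dC]).det) :
    Ideal.span (Set.range dG) = Ideal.span {A, B} ⊔ Ideal.span {C ^ n} := by
  set I : Ideal S := Ideal.span {A, B} ⊔ Ideal.span {C ^ n} with hI
  have hAI : A ∈ I := Ideal.mem_sup_left (Ideal.subset_span (by simp))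
  have hBI : B ∈ I := Ideal.mem_sup_left (Ideal.subset_span (by simp))
  have hCI : C ^ n ∈ I := Ideal.mem_sup_right (Ideal.mem_span_singleton_self _)
  have hCm : C ^ (n + 1) ∈ IsLocalRing.maximalIdeal S * I := by
    rw [pow_succ']; exact Ideal.mul_mem_mul hC hCI
  have hGm : G ∈ IsLocalRing.maximalIdeal S * I := by
    rw [← Ideal.unit_mul_mem_iff_mem _ hv, hG]
    exact add_mem (Ideal.mul_mem_mul hA hBI) (Ideal.mul_mem_left _ _ hCm)
  -- up to terms in the maximal ideal times `I`, the vector `v dG` is the transform `M x` of `x`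
  let x : Fin 3 → S := ![B, A, ((n + 1 : ℕ) : S) * w * C ^ n]
  let M : Matrix (Fin 3) (Fin 3) S := (Matrix.of ![dA, dB, dC]).transpose
  have hM : IsUnit M.det := by rwa [Matrix.det_transpose]
  have hxI : Ideal.span (Set.range x) = I := by
    apply le_antisymm
    · rw [Ideal.span_le]
      rintro _ ⟨i, rfl⟩
      fin_cases i
      exacts [hBI, hAI, Ideal.mul_mem_left _ _ hCI]
    · refine sup_le ?_ ?_
      · rw [Ideal.span_le]
        rintro _ (rfl | rfl)
        exacts [Ideal.subset_span ⟨1, rfl⟩, Ideal.subset_span ⟨0, rfl⟩]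
      · rw [Ideal.span_le, Set.singleton_subset_iff]
        exact (Ideal.unit_mul_mem_iff_mem _ (hn.mul hw)).mp (Ideal.subset_span ⟨2, rfl⟩)
  have hspan : Ideal.span (Set.range (M.mulVec x)) = I :=
    (Ideal.span_range_eq_of_mulVec hM rfl).trans hxI
  have hder : ∀ i, v * dG i - M.mulVec x i ∈ IsLocalRing.maximalIdeal S * I := by
    intro i
    have h2 : M.mulVec x i = dA i * B + dB i * A + dC i * (((n + 1 : ℕ) : S) * w * C ^ n) := by
      simp [Matrix.mulVec, dotProduct, Fin.sum_univ_three, M, x]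
    have h3 : v * dG i - M.mulVec x i = dw i * C ^ (n + 1) - dv i * G := by
      rw [h2]
      linear_combination hd i
    rw [h3]
    exact sub_mem (Ideal.mul_mem_left _ _ hCm) (Ideal.mul_mem_left _ _ hGm)
  have hle : IsLocalRing.maximalIdeal S * I ≤ I := Ideal.mul_le_right
  apply le_antisymm
  · rw [Ideal.span_le]
    rintro _ ⟨i, rfl⟩
    refine (Ideal.unit_mul_mem_iff_mem _ hv).mp ?_
    have h4 : M.mulVec x i ∈ I := by rw [← hspan]; exact Ideal.subset_span ⟨i, rfl⟩
    have h5 : v * dG i - M.mulVec x i ∈ I := hle (hder i)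
    have h6 := I.add_mem h5 h4
    rwa [sub_add_cancel] at h6
  · refine Submodule.le_of_le_smul_of_le_jacobson_bot (I := IsLocalRing.maximalIdeal S) ?_
      (IsLocalRing.maximalIdeal_le_jacobson _) ?_
    · exact Submodule.FG.sup (Submodule.fg_span (Set.toFinite _))
        (Submodule.fg_span (Set.toFinite _))
    · nth_rw 1 [← hspan]
      rw [Ideal.span_le]
      rintro _ ⟨i, rfl⟩
      have h5 : M.mulVec x i = v * dG i + -(v * dG i - M.mulVec x i) := by ring
      rw [h5]
      exact Submodule.add_mem_sup (Ideal.mul_mem_left _ _ (Ideal.subset_span ⟨i, rfl⟩))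
        (neg_mem (hder i))

/-! ### Local coordinates at the origin and Milnor numbers -/

namespace MonoidSurface

open MvPolynomial

/-- The polynomials `a₀, a₁, a₂` are local coordinates at the origin: they vanish there, and their
Jacobian determinant does not. -/
structure IsLocalCoordinates {K : Type*} [Field K] (a : Fin 3 → MvPolynomial (Fin 3) K) :
    Prop where
  eval_zero : ∀ i, eval 0 (a i) = 0
  det_ne_zero : (Matrix.of fun i j => eval 0 (pderiv j (a i))).det ≠ 0

variable {K : Type*} [Field K]

theorem mem_originIdeal {p : MvPolynomial (Fin 3) K} : p ∈ originIdeal K ↔ eval 0 p = 0 :=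
  Iff.rfl

theorem coeff_single_one_coe (p : MvPolynomial (Fin 3) K) (j : Fin 3) :
    MvPowerSeries.coeff (Finsupp.single j 1) (p : MvPowerSeries (Fin 3) K) =
      eval 0 (pderiv j p) := by
  rw [coeff_coe, eval_zero, constantCoeff_eq, coeff_pderiv]
  simp

theorem constantCoeff_coe (p : MvPolynomial (Fin 3) K) :
    MvPowerSeries.constantCoeff (p : MvPowerSeries (Fin 3) K) = eval 0 p := by
  rw [← MvPowerSeries.coeff_zero_eq_constantCoeff_apply, coeff_coe, eval_zero, constantCoeff_eq]

theorem exists_eq_sum_mul_X {p : MvPolynomial (Fin 3) K} (hp : eval 0 p = 0) :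
    ∃ q : Fin 3 → MvPolynomial (Fin 3) K, p = ∑ j, q j * X j ∧
      ∀ j, eval 0 (q j) = eval 0 (pderiv j p) := by
  have hmem : p ∈ Ideal.span (Set.range (X : Fin 3 → MvPolynomial (Fin 3) K)) := by
    have h := (mem_pow_idealOfVars_iff' 1 p).mpr (fun x hx => by
      have : x = 0 := (Finsupp.degree_eq_zero_iff x).mp (by omega)
      rwa [this, ← constantCoeff_eq, ← eval_zero])
    rwa [pow_one] at h
  obtain ⟨q, hq⟩ := (Ideal.mem_span_range_iff_exists_fun).mp hmem
  refine ⟨q, hq.symm, fun j => ?_⟩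
  rw [← hq, map_sum, map_sum]
  simp only [Derivation.leibniz, pderiv_X, smul_eq_mul, map_add, map_mul, eval_X, Pi.zero_apply,
    zero_mul, add_zero]
  rw [Finset.sum_eq_single j (fun k _ hk => by simp [hk.symm]) (by simp)]
  simp

/-- The local ring of affine space at the origin. -/
abbrev OriginLocalRing (K : Type*) [Field K] := Localization.AtPrime (originIdeal K)

theorem isUnit_algebraMap_of_eval_ne_zero {p : MvPolynomial (Fin 3) K} (hp : eval 0 p ≠ 0) :
    IsUnit (algebraMap _ (OriginLocalRing K) p) :=
  (IsLocalization.AtPrime.isUnit_to_map_iff (OriginLocalRing K) (originIdeal K) p).mpr hp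

theorem IsLocalCoordinates.maximalIdeal_eq_span {a : Fin 3 → MvPolynomial (Fin 3) K}
    (ha : IsLocalCoordinates a) :
    IsLocalRing.maximalIdeal (OriginLocalRing K) =
      Ideal.span (Set.range fun i => algebraMap _ (OriginLocalRing K) (a i)) := by
  choose q hq hq0 using fun i => exists_eq_sum_mul_X (ha.eval_zero i)
  have hX : originIdeal K = Ideal.span (Set.range (X : Fin 3 → MvPolynomial (Fin 3) K)) := by
    apply le_antisymm
    · intro p hp
      obtain ⟨q, rfl, -⟩ := exists_eq_sum_mul_X (mem_originIdeal.mp hp)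
      exact Ideal.sum_mem _ fun j _ => Ideal.mul_mem_left _ _ (Ideal.subset_span ⟨j, rfl⟩)
    · rw [Ideal.span_le]
      rintro _ ⟨j, rfl⟩
      simp [mem_originIdeal]
  rw [← IsLocalization.AtPrime.map_eq_maximalIdeal (originIdeal K) (OriginLocalRing K),
    congrArg (Ideal.map _) hX, Ideal.map_span, ← Set.range_comp]
  symm
  refine Ideal.span_range_eq_of_mulVec
    (M := (algebraMap _ (OriginLocalRing K)).mapMatrix (Matrix.of q)) ?_ ?_
  · rw [← RingHom.map_det]
    refine isUnit_algebraMap_of_eval_ne_zero ?_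
    rw [RingHom.map_det]
    convert ha.det_ne_zero using 2
    ext i j
    exact hq0 i j
  · funext i
    conv_lhs => rw [hq i]
    simp [Matrix.mulVec, dotProduct]

/-- The embedding of the local ring of the origin into its completion. -/
noncomputable def originLocalRingToPowerSeries (K : Type*) [Field K] :
    OriginLocalRing K →+* MvPowerSeries (Fin 3) K :=
  IsLocalization.lift (M := (originIdeal K).primeCompl)
    (g := (coeToMvPowerSeries.ringHom : MvPolynomial (Fin 3) K →+* _)) (by
      rintro ⟨p, hp⟩
      rw [MvPowerSeries.isUnit_iff_constantCoeff, isUnit_iff_ne_zero]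
      change MvPowerSeries.constantCoeff (p : MvPowerSeries (Fin 3) K) ≠ 0
      rw [constantCoeff_coe]
      exact hp)

theorem originLocalRingToPowerSeries_algebraMap (p : MvPolynomial (Fin 3) K) :
    originLocalRingToPowerSeries K (algebraMap _ _ p) = p :=
  IsLocalization.lift_eq _ p

/-- In formal coordinates this says that `y₂ⁿ` does not lie in `(y₀, y₁, y₂ⁿ⁺¹)`. -/
theorem IsLocalCoordinates.pow_notMem {a : Fin 3 → MvPolynomial (Fin 3) K}
    (ha : IsLocalCoordinates a) (n : ℕ) :
    algebraMap _ (OriginLocalRing K) (a 2) ^ n ∉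
      Ideal.span {algebraMap _ (OriginLocalRing K) (a 0), algebraMap _ (OriginLocalRing K) (a 1)} ⊔
        Ideal.span {algebraMap _ (OriginLocalRing K) (a 2) ^ (n + 1)} := by
  intro h
  obtain ⟨φ, hφ⟩ := MvPowerSeries.exists_algEquiv_X
    (fun i => (a i : MvPowerSeries (Fin 3) K))
    (fun i => by rw [constantCoeff_coe, ha.eval_zero])
    (by
      simp only [coeff_single_one_coe]
      exact isUnit_iff_ne_zero.mpr ha.det_ne_zero)
  obtain ⟨_, h₁, _, h₂, h⟩ := Submodule.mem_sup.mp h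
  obtain ⟨p, q, rfl⟩ := Ideal.mem_span_pair.mp h₁
  obtain ⟨r, rfl⟩ := Ideal.mem_span_singleton'.mp h₂
  have h' := congrArg (fun z => φ.symm (originLocalRingToPowerSeries K z)) h
  have hs : ∀ i, φ.symm (a i : MvPowerSeries (Fin 3) K) = MvPowerSeries.X i := fun i => by
    rw [← hφ i, φ.symm_apply_apply]
  simp only [map_add, map_mul, map_pow, originLocalRingToPowerSeries_algebraMap, hs] at h'
  have h'' := congrArg (MvPowerSeries.coeff (Finsupp.single 2 n)) h'
  rw [map_add, map_add, MvPowerSeries.coeff_X_pow, if_pos rfl, mul_comm, MvPowerSeries.X,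
    MvPowerSeries.X, mul_comm _ (MvPowerSeries.monomial _ _), MvPowerSeries.X_pow_eq,
    mul_comm _ (MvPowerSeries.monomial _ _), MvPowerSeries.coeff_monomial_mul,
    MvPowerSeries.coeff_monomial_mul, MvPowerSeries.coeff_monomial_mul, if_neg, if_neg,
    if_neg] at h''
  · simp at h''
  · intro hle
    simpa using hle 2
  · intro hle
    simpa using hle 1
  · intro hle
    simpa using hle 0

theorem length_residueField_originLocalRing :
    Module.length K (OriginLocalRing K ⧸ IsLocalRing.maximalIdeal (OriginLocalRing K)) = 1 := by
  set S := OriginLocalRing K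
  have : Nontrivial (S ⧸ IsLocalRing.maximalIdeal S) :=
    Ideal.Quotient.nontrivial_iff.mpr (IsLocalRing.maximalIdeal.isMaximal S).ne_top
  have hbij : Function.Bijective (algebraMap K (S ⧸ IsLocalRing.maximalIdeal S)) := by
    refine ⟨RingHom.injective _, fun z => ?_⟩
    obtain ⟨z, rfl⟩ := Ideal.Quotient.mk_surjective z
    obtain ⟨⟨p, s⟩, hps⟩ := IsLocalization.surj (originIdeal K).primeCompl z
    have hs0 : eval 0 (s : MvPolynomial (Fin 3) K) ≠ 0 := s.2
    set c : K := eval 0 p / eval 0 (s : MvPolynomial (Fin 3) K)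
    refine ⟨c, ?_⟩
    have hc : algebraMap K (S ⧸ IsLocalRing.maximalIdeal S) c =
        Ideal.Quotient.mk _ (algebraMap (MvPolynomial (Fin 3) K) S (C c)) := by
      rw [← MvPolynomial.algebraMap_eq, ← IsScalarTower.algebraMap_apply]; rfl
    rw [hc, Ideal.Quotient.eq]
    have hmem : algebraMap (MvPolynomial (Fin 3) K) S (C c * (s : MvPolynomial (Fin 3) K) - p) ∈
        IsLocalRing.maximalIdeal S := by
      rw [IsLocalization.AtPrime.to_map_mem_maximal_iff S (originIdeal K), mem_originIdeal,
        map_sub, map_mul, eval_C, div_mul_cancel₀ _ hs0, sub_self]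
    have heq : algebraMap (MvPolynomial (Fin 3) K) S (C c * (s : MvPolynomial (Fin 3) K) - p) =
        (algebraMap (MvPolynomial (Fin 3) K) S (C c) - z) *
          algebraMap (MvPolynomial (Fin 3) K) S (s : MvPolynomial (Fin 3) K) := by
      rw [map_sub, map_mul, ← hps]; ring
    rw [heq] at hmem
    exact (Ideal.unit_mul_mem_iff_mem _ (isUnit_algebraMap_of_eval_ne_zero hs0)).mp
      (by rwa [mul_comm])
  rw [← (LinearEquiv.ofBijective (Algebra.linearMap K _) hbij).length_eq]
  exact Module.length_eq_one K K

/-- The Milnor number of a surface germ with equation `A B + w Cᵐ`, up to a unit `v`, where `A`,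
`B`, `C` are local coordinates and `w` is a unit. -/
theorem milnorNumber_eq_sub_one [CharZero K] {G A B C v w : MvPolynomial (Fin 3) K} {m : ℕ}
    (hm : m ≠ 0) (hG : v * G = A * B + w * C ^ m) (ha : IsLocalCoordinates ![A, B, C])
    (hv : eval 0 v ≠ 0) (hw : eval 0 w ≠ 0) :
    milnorNumber G = ((m - 1 : ℕ) : ℕ∞) := by
  obtain ⟨n, rfl⟩ := Nat.exists_eq_succ_of_ne_zero hm
  let ι := algebraMap (MvPolynomial (Fin 3) K) (OriginLocalRing K)
  have hmax := ha.maximalIdeal_eq_span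
  have hJI : Ideal.span (Set.range fun i => ι (pderiv i G)) =
      Ideal.span {ι A, ι B} ⊔ Ideal.span {ι C ^ n} := by
    refine IsLocalRing.span_range_partials_eq (dA := fun i => ι (pderiv i A))
      (dB := fun i => ι (pderiv i B)) (dC := fun i => ι (pderiv i C))
      (dv := fun i => ι (pderiv i v)) (dw := fun i => ι (pderiv i w)) (G := ι G)
      ?_ ?_ (isUnit_algebraMap_of_eval_ne_zero hv) (isUnit_algebraMap_of_eval_ne_zero hw) ?_ ?_
      (fun i => ?_) ?_
    · rw [hmax]; exact Ideal.subset_span ⟨0, rfl⟩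
    · rw [hmax]; exact Ideal.subset_span ⟨2, rfl⟩
    · rw [← map_natCast ι]
      refine isUnit_algebraMap_of_eval_ne_zero ?_
      rw [map_natCast]
      exact Nat.cast_ne_zero.mpr n.succ_ne_zero
    · rw [← map_mul, hG, map_add, map_mul, map_mul, map_pow]
    · have h := congrArg (fun p => ι (pderiv i p)) hG
      simp only [Derivation.leibniz, Derivation.leibniz_pow, map_add, map_mul, map_pow,
        smul_eq_mul, nsmul_eq_mul, map_natCast, Nat.succ_eq_add_one, Nat.add_sub_cancel] at h
      linear_combination h
    · have hM : Matrix.of ![fun i => ι (pderiv i A), fun i => ι (pderiv i B),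
          fun i => ι (pderiv i C)] =
          ι.mapMatrix (Matrix.of fun i j => pderiv j (![A, B, C] i)) := by
        ext i j
        fin_cases i <;> rfl
      rw [hM, ← RingHom.map_det]
      refine isUnit_algebraMap_of_eval_ne_zero ?_
      rw [RingHom.map_det]
      exact ha.det_ne_zero
  have hlen := IsLocalRing.length_quotient_sup_span_pow K length_residueField_originLocalRing
    (Ideal.span {ι A, ι B}) (ι C) (by
      rw [hmax, ← Ideal.span_union]
      congr 1
      ext z
      simp only [Set.mem_range, Fin.exists_fin_succ]
      simp [eq_comm, ι]
      tauto) (fun k => ha.pow_notMem k) n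
  rw [Module.length_eq_rank, ← hJI] at hlen
  exact hlen

end MonoidSurface

/-! ### Homogeneous and coprime polynomials -/

namespace MvPolynomial

theorem IsHomogeneous.aeval_mul_left {σ R T : Type*} [CommSemiring R] [CommSemiring T]
    [Algebra R T] {q : MvPolynomial σ R} {e : ℕ} (hq : q.IsHomogeneous e) (t : T) (x : σ → T) :
    MvPolynomial.aeval (fun i => t * x i) q = t ^ e * MvPolynomial.aeval x q := by
  rw [aeval_def, aeval_def, eval₂_eq, eval₂_eq, Finset.mul_sum]
  refine Finset.sum_congr rfl fun m hm => ?_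
  have hdeg : ∑ i ∈ m.support, m i = e := by
    rw [hq.degree_eq_sum_deg_support hm]
  simp only [mul_pow, Finset.prod_mul_distrib, Finset.prod_pow_eq_pow_sum, hdeg]
  ring

/-- Coprimality of polynomials persists under extension of the base field, in the form that
is needed: the coefficients of `s` and `a` are expanded in a basis of the extension. -/
theorem map_dvd_of_mul_map_eq {σ k K : Type*} [Field k] [Field K] [Algebra k K]
    {f g : MvPolynomial σ k} (hfg : IsRelPrime f g) {s a : MvPolynomial σ K}
    (h : s * map (algebraMap k K) g = a * map (algebraMap k K) f) :
    map (algebraMap k K) f ∣ s := by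
  classical
  let e := Module.Basis.ofVectorSpace k K
  -- the `i`-th coordinate of a polynomial over `K`
  let D := fun (i : Module.Basis.ofVectorSpaceIndex k K) (q : MvPolynomial σ K) =>
    (∑ m ∈ q.support, monomial m (e.repr (coeff m q) i) : MvPolynomial σ k)
  have hD : ∀ i q m, coeff m (D i q) = e.repr (coeff m q) i := by
    intro i q m
    simp only [D, coeff_sum, coeff_monomial, Finset.sum_ite_eq']
    split_ifs with hm
    · rfl
    · rw [notMem_support_iff.mp hm]; simp
  have hDmul : ∀ i q (r : MvPolynomial σ k), D i (q * map (algebraMap k K) r) = D i q * r := by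
    intro i q r
    ext m
    rw [hD, coeff_mul, coeff_mul, map_sum, Finsupp.finsetSum_apply]
    refine Finset.sum_congr rfl fun x _ => ?_
    rw [coeff_map, hD, mul_comm, ← Algebra.smul_def, map_smul, Finsupp.smul_apply, smul_eq_mul,
      mul_comm]
  have hdvd : ∀ i, f ∣ D i s := by
    intro i
    refine hfg.dvd_of_dvd_mul_right ?_
    rw [← hDmul, h, hDmul]
    exact dvd_mul_left _ _
  choose b hb using hdvd
  let T := s.support.biUnion fun m => (e.repr (coeff m s)).support
  have hs : s = ∑ i ∈ T, C (e i) * map (algebraMap k K) (D i s) := by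
    ext m
    have h1 : coeff m s = ∑ i ∈ T, (e.repr (coeff m s) i) • e i := by
      conv_lhs => rw [← e.linearCombination_repr (coeff m s)]
      rw [Finsupp.linearCombination_apply]
      refine Finsupp.sum_of_support_subset _ ?_ _ (by simp)
      by_cases hm : m ∈ s.support
      · exact Finset.subset_biUnion_of_mem (fun m => (e.repr (coeff m s)).support) hm
      · rw [notMem_support_iff.mp hm]; simp
    rw [coeff_sum]
    conv_lhs => rw [h1]
    refine Finset.sum_congr rfl fun i _ => ?_
    rw [coeff_C_mul, coeff_map, hD, Algebra.smul_def, mul_comm]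
  rw [hs]
  refine Finset.dvd_sum fun i _ => ?_
  rw [hb, map_mul]
  exact Dvd.dvd.mul_left (dvd_mul_right _ _) _

end MvPolynomial

/-! ### Elements of a local ring with principal maximal ideal -/

/-- If `c` generates the maximal ideal of the Noetherian local ring `S` modulo `I`, every element
outside `I` is a power of `c` times a unit modulo `I`. -/
theorem IsLocalRing.exists_sub_mul_pow_mem {S : Type*} [CommRing S] [IsLocalRing S]
    [IsNoetherianRing S] {I : Ideal S} {c : S}
    (hmax : IsLocalRing.maximalIdeal S = I ⊔ Ideal.span {c}) {h : S} (hh : h ∉ I) :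
    ∃ (m : ℕ) (u : S), IsUnit u ∧ h - u * c ^ m ∈ I := by
  -- otherwise `h` lies in all the ideals `I + (cⁿ)`, and Krull's intersection theorem applies
  by_contra hcon
  push Not at hcon
  have hall : ∀ n, ∃ x, h - x * c ^ n ∈ I := by
    intro n
    induction n with
    | zero => exact ⟨h, by simp⟩
    | succ n ih =>
      obtain ⟨x, hx⟩ := ih
      have hxm : x ∈ IsLocalRing.maximalIdeal S := by
        rw [IsLocalRing.mem_maximalIdeal, mem_nonunits_iff]
        exact fun hu => hcon n x hu hx
      rw [hmax] at hxm
      obtain ⟨i, hi, z, hz, rfl⟩ := Submodule.mem_sup.mp hxm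
      obtain ⟨y, rfl⟩ := Ideal.mem_span_singleton'.mp hz
      refine ⟨y, ?_⟩
      have : h - y * c ^ (n + 1) = (h - (i + y * c) * c ^ n) + i * c ^ n := by ring
      rw [this]
      exact add_mem hx (Ideal.mul_mem_right _ _ hi)
  have hI : I ≠ ⊤ := by
    rintro rfl
    exact hh trivial
  have : Nontrivial (S ⧸ I) := Ideal.Quotient.nontrivial_iff.mpr hI
  have : IsLocalRing (S ⧸ I) :=
    IsLocalRing.of_surjective' (Ideal.Quotient.mk I) Ideal.Quotient.mk_surjective
  have hcm : c ∈ IsLocalRing.maximalIdeal S := by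
    rw [hmax]; exact Ideal.mem_sup_right (Ideal.mem_span_singleton_self c)
  have hIm : I ≤ IsLocalRing.maximalIdeal S := by rw [hmax]; exact le_sup_left
  have hne : Ideal.span {Ideal.Quotient.mk I c} ≠ ⊤ := by
    rw [Ne, Ideal.span_singleton_eq_top]
    intro hu
    obtain ⟨b, hb⟩ := hu.exists_right_inv
    obtain ⟨b, rfl⟩ := Ideal.Quotient.mk_surjective b
    rw [← map_mul, ← map_one (Ideal.Quotient.mk I), Ideal.Quotient.eq] at hb
    have h1 : (1 : S) ∈ IsLocalRing.maximalIdeal S := by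
      have := sub_mem (Ideal.mul_mem_right b _ hcm) (hIm hb)
      rwa [sub_sub_cancel] at this
    exact (Ideal.ne_top_iff_one _).mp (IsLocalRing.maximalIdeal.isMaximal S).ne_top h1
  have hinf := Ideal.iInf_pow_eq_bot_of_isLocalRing _ hne
  apply hh
  rw [← Ideal.Quotient.eq_zero_iff_mem, ← Ideal.mem_bot, ← hinf, Ideal.mem_iInf]
  intro n
  obtain ⟨x, hx⟩ := hall n
  rw [(Ideal.Quotient.eq).mpr hx, map_mul, map_pow, Ideal.span_singleton_pow]
  exact Ideal.mul_mem_left _ _ (Ideal.mem_span_singleton_self _)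

/-! ### The local ring of a plane curve at a smooth point -/

namespace MonoidSurface

open MvPolynomial

variable {K : Type*} [Field K]

/-- Restriction of a polynomial to the line spanned by `p`, with coordinate `t ↦ t p`. -/
noncomputable def lineEval (p : Fin 3 → K) : MvPolynomial (Fin 3) K →ₐ[K] Polynomial K :=
  aeval fun i => Polynomial.C (p i) * Polynomial.X

theorem mem_pointIdeal {p : Fin 3 → K} {q : MvPolynomial (Fin 3) K} :
    q ∈ pointIdeal p ↔ lineEval p q = 0 :=
  Iff.rfl

theorem eval_lineEval (p : Fin 3 → K) (t : K) (q : MvPolynomial (Fin 3) K) :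
    (lineEval p q).eval t = eval (t • p) q := by
  induction q using MvPolynomial.induction_on with
  | C a => simp [lineEval]
  | add q r hq hr => rw [map_add, Polynomial.eval_add, hq, hr, map_add]
  | mul_X q i hq => rw [map_mul, Polynomial.eval_mul, hq, map_mul]; simp [lineEval, mul_comm t]

theorem lineEval_of_isHomogeneous (p : Fin 3 → K) {q : MvPolynomial (Fin 3) K} {e : ℕ}
    (hq : q.IsHomogeneous e) :
    lineEval p q = Polynomial.X ^ e * Polynomial.C (eval p q) := by
  have h := hq.aeval_mul_left (Polynomial.X : Polynomial K) (fun i => Polynomial.C (p i))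
  have h2 : aeval (fun i => Polynomial.C (p i)) q = Polynomial.C (eval p q) := by
    rw [show (fun i => Polynomial.C (p i)) = algebraMap K (Polynomial K) ∘ p from rfl,
      aeval_algebraMap_apply, Polynomial.algebraMap_eq,
      aeval_eq_eval]
  rw [h2] at h
  rw [← h, lineEval]
  congr 2
  funext i
  exact mul_comm _ _

/-- The linear form with the given coefficients. -/
noncomputable def linForm (c : Fin 3 → K) : MvPolynomial (Fin 3) K :=
  ∑ i, C (c i) * X i

theorem eval_linForm (c x : Fin 3 → K) : eval x (linForm c) = c ⬝ᵥ x := by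
  simp [linForm, dotProduct]

theorem pderiv_linForm (c : Fin 3 → K) (i : Fin 3) : pderiv i (linForm c) = C (c i) := by
  rw [linForm, map_sum, Finset.sum_eq_single i]
  · rw [pderiv_C_mul, pderiv_X_self, mul_one]
  · intro j _ hj
    rw [pderiv_C_mul, pderiv_X_of_ne hj, mul_zero]
  · simp

theorem lineEval_linForm (p c : Fin 3 → K) (h : c ⬝ᵥ p = 0) : lineEval p (linForm c) = 0 := by
  have h1 : (linForm c).IsHomogeneous 1 :=
    IsHomogeneous.sum _ _ _ fun i _ => isHomogeneous_C_mul_X _ _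
  rw [lineEval_of_isHomogeneous p h1, eval_linForm, h, map_zero, mul_zero]

/-- The vectors `l` and `c` form a basis of the orthogonal complement of `p`. -/
structure IsOrthogonalBasis (p l c : Fin 3 → K) : Prop where
  left : l ⬝ᵥ p = 0
  right : c ⬝ᵥ p = 0
  exists_eq : ∀ v : Fin 3 → K, v ⬝ᵥ p = 0 → ∃ α β : K, v = α • l + β • c
  indep : ∀ α β : K, α • l + β • c = 0 → α = 0 ∧ β = 0

theorem exists_isOrthogonalBasis {p l : Fin 3 → K} (hp : p ≠ 0) (hl : l ≠ 0) (hlp : l ⬝ᵥ p = 0) :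
    ∃ c, IsOrthogonalBasis p l c := by
  let φ : (Fin 3 → K) →ₗ[K] K := Fintype.linearCombination K p
  have hφ : ∀ v, φ v = v ⬝ᵥ p := fun v => by
    simp [φ, Fintype.linearCombination_apply, dotProduct]
  obtain ⟨j, hj⟩ := Function.ne_iff.mp hp
  have hφ0 : φ ≠ 0 := by
    intro h
    have h1 : φ (Pi.single j 1) = 0 := by rw [h]; rfl
    rw [hφ, single_one_dotProduct] at h1
    exact hj h1
  have hrank : Module.finrank K (LinearMap.ker φ) = 2 := by
    have h1 := LinearMap.finrank_range_add_finrank_ker φ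
    rw [LinearMap.range_eq_top.mpr (LinearMap.surjective hφ0), finrank_top, Module.finrank_self,
      Module.finrank_fin_fun] at h1
    omega
  let l' : LinearMap.ker φ := ⟨l, by rw [LinearMap.mem_ker, hφ, hlp]⟩
  obtain ⟨c, hc⟩ := exists_linearIndependent_pair_of_one_lt_finrank (R := K)
    (by rw [hrank]; norm_num : 1 < Module.finrank K (LinearMap.ker φ)) (x := l')
    (fun h => hl (congrArg Subtype.val h))
  have hspan := hc.span_eq_top_of_card_eq_finrank (by rw [hrank]; simp)
  refine ⟨c, hlp, by rw [← hφ]; exact c.2, fun v hv => ?_, fun α β h => ?_⟩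
  · have hmem : (⟨v, by rw [LinearMap.mem_ker, hφ, hv]⟩ : LinearMap.ker φ) ∈
        Submodule.span K (Set.range ![l', c]) := by rw [hspan]; trivial
    rw [Matrix.range_cons, Matrix.range_cons, Matrix.range_empty, Set.union_empty,
      Set.singleton_union, Submodule.mem_span_pair] at hmem
    obtain ⟨α, β, h⟩ := hmem
    exact ⟨α, β, (congrArg Subtype.val h).symm⟩
  · exact (LinearIndependent.pair_iff.mp hc) α β (Subtype.ext h)

theorem IsOrthogonalBasis.exists_eq_smul {p l c v : Fin 3 → K} (hb : IsOrthogonalBasis p l c)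
    (hp : p ≠ 0) (hl : l ⬝ᵥ v = 0) (hc : c ⬝ᵥ v = 0) : ∃ μ : K, v = μ • p := by
  obtain ⟨j, hj⟩ := Function.ne_iff.mp hp
  replace hj : p j ≠ 0 := hj
  refine ⟨v j / p j, funext fun i => ?_⟩
  obtain ⟨α, β, h⟩ := hb.exists_eq (p j • Pi.single i 1 - p i • Pi.single j 1) (by
    rw [sub_dotProduct, smul_dotProduct, smul_dotProduct, single_one_dotProduct,
      single_one_dotProduct, smul_eq_mul, smul_eq_mul, mul_comm, sub_self])
  have h1 := congrArg (· ⬝ᵥ v) h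
  simp only [sub_dotProduct, smul_dotProduct, single_one_dotProduct, add_dotProduct, hl, hc,
    smul_eq_mul, mul_zero, add_zero] at h1
  rw [Pi.smul_apply, smul_eq_mul]
  field_simp
  linear_combination h1

theorem IsOrthogonalBasis.indep_polynomial {p l c : Fin 3 → K} (hb : IsOrthogonalBasis p l c)
    {a b : Polynomial K} (h : ∀ i, a * Polynomial.C (l i) + b * Polynomial.C (c i) = 0) :
    a = 0 ∧ b = 0 := by
  have h1 : ∀ n, a.coeff n = 0 ∧ b.coeff n = 0 := fun n => hb.indep _ _ (funext fun i => by
    simpa using congrArg (Polynomial.coeff · n) (h i))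
  exact ⟨Polynomial.ext fun n => (h1 n).1, Polynomial.ext fun n => (h1 n).2⟩

theorem IsOrthogonalBasis.pointIdeal_eq {p l c : Fin 3 → K} (hb : IsOrthogonalBasis p l c)
    (hp : p ≠ 0) : pointIdeal p = Ideal.span {linForm l, linForm c} := by
  apply le_antisymm
  · rw [pointIdeal_eq_span p hp, Ideal.span_le]
    rintro _ ⟨⟨i, j⟩, rfl⟩
    obtain ⟨α, β, h⟩ := hb.exists_eq (p j • Pi.single i 1 - p i • Pi.single j 1) (by
      rw [sub_dotProduct, smul_dotProduct, smul_dotProduct, single_one_dotProduct,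
        single_one_dotProduct, smul_eq_mul, smul_eq_mul, mul_comm, sub_self])
    refine Ideal.mem_span_pair.mpr ⟨C α, C β, ?_⟩
    have h1 : linForm (α • l + β • c) = C α * linForm l + C β * linForm c := by
      simp only [linForm, Finset.mul_sum, ← Finset.sum_add_distrib, Pi.add_apply, Pi.smul_apply,
        smul_eq_mul, map_add, map_mul]
      exact Finset.sum_congr rfl fun k _ => by ring
    rw [← h1, ← h]
    simp only [linForm, Pi.sub_apply, Pi.smul_apply, smul_eq_mul, map_sub, map_mul, sub_mul,
      Finset.sum_sub_distrib]
    rw [Finset.sum_eq_single i (fun k _ hk => by simp [hk]) (by simp),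
      Finset.sum_eq_single j (fun k _ hk => by simp [hk]) (by simp)]
    simp
  · rw [Ideal.span_le]
    rintro _ (rfl | rfl)
    exacts [lineEval_linForm p l hb.left, lineEval_linForm p c hb.right]

/-- The local ring of the plane at the point `p`, as the localization at its homogeneous ideal. -/
abbrev PointLocalRing (p : Fin 3 → K) := Localization.AtPrime (pointIdeal p)

theorem algebraMap_pointLocalRing_injective (p : Fin 3 → K) :
    Function.Injective (algebraMap (MvPolynomial (Fin 3) K) (PointLocalRing p)) :=
  IsLocalization.injective _ (pointIdeal p).primeCompl_le_nonZeroDivisors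

theorem isUnit_algebraMap_pointLocalRing {p : Fin 3 → K} {q : MvPolynomial (Fin 3) K}
    (hq : q ∉ pointIdeal p) : IsUnit (algebraMap _ (PointLocalRing p) q) :=
  (IsLocalization.AtPrime.isUnit_to_map_iff (PointLocalRing p) (pointIdeal p) q).mpr hq

/-- The local ring of a plane curve at a smooth point has principal maximal ideal, generated by
any linear form transverse to the tangent. -/
theorem maximalIdeal_pointLocalRing {p c : Fin 3 → K} {f : MvPolynomial (Fin 3) K} {e : ℕ}
    (hp : p ≠ 0) (hf : f.IsHomogeneous (e + 1)) (hfp : eval p f = 0)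
    (hb : IsOrthogonalBasis p (fun i => eval p (pderiv i f)) c) :
    IsLocalRing.maximalIdeal (PointLocalRing p) =
      Ideal.span {algebraMap _ (PointLocalRing p) f} ⊔
        Ideal.span {algebraMap _ (PointLocalRing p) (linForm c)} := by
  set l : Fin 3 → K := fun i => eval p (pderiv i f) with hl
  have hfmem : f ∈ pointIdeal p := by
    rw [mem_pointIdeal, lineEval_of_isHomogeneous p hf, hfp, map_zero, mul_zero]
  obtain ⟨α, β, hαβ⟩ := Ideal.mem_span_pair.mp (hb.pointIdeal_eq hp ▸ hfmem)
  have hεl := lineEval_linForm p l hb.left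
  have hεc := lineEval_linForm p c hb.right
  -- comparing gradients along the line gives `α = tᵉ` and `β = 0` there
  have hcomp := hb.indep_polynomial (a := lineEval p α - Polynomial.X ^ e) (b := lineEval p β)
    fun i => by
      have h1 := congrArg (fun q => lineEval p (pderiv i q)) hαβ
      have h2 : lineEval p (pderiv i f) = Polynomial.X ^ e * Polynomial.C (l i) :=
        lineEval_of_isHomogeneous p hf.pderiv
      have hC : ∀ x : K, lineEval p (C x) = Polynomial.C x := fun x => by simp [lineEval]
      simp only [map_add, map_mul, pderiv_mul, pderiv_linForm, h2, hεl, hεc, hC] at h1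
      linear_combination h1
  have hα : α ∉ pointIdeal p := by
    rw [mem_pointIdeal, sub_eq_zero.mp hcomp.1]
    exact pow_ne_zero _ Polynomial.X_ne_zero
  rw [← IsLocalization.AtPrime.map_eq_maximalIdeal (pointIdeal p) (PointLocalRing p)]
  set ι := algebraMap (MvPolynomial (Fin 3) K) (PointLocalRing p)
  rw [congrArg (Ideal.map ι) (hb.pointIdeal_eq hp), Ideal.map_span, Set.image_pair]
  have hι : ι α * ι (linForm l) = ι f - ι β * ι (linForm c) := by
    rw [← hαβ, map_add, map_mul, map_mul]; ring
  apply le_antisymm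
  · rw [Ideal.span_le]
    rintro _ (rfl | rfl)
    · refine (Ideal.unit_mul_mem_iff_mem _ (isUnit_algebraMap_pointLocalRing hα)).mp ?_
      change ι α * ι (linForm l) ∈ _
      rw [hι]
      exact sub_mem (Ideal.mem_sup_left (Ideal.mem_span_singleton_self _))
        (Ideal.mem_sup_right (Ideal.mul_mem_left _ _ (Ideal.mem_span_singleton_self _)))
    · exact Ideal.mem_sup_right (Ideal.mem_span_singleton_self _)
  · refine sup_le ?_ ?_
    · rw [Ideal.span_le, Set.singleton_subset_iff, ← hαβ]
      exact Ideal.mem_span_pair.mpr ⟨ι α, ι β, by rw [map_add, map_mul, map_mul]⟩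
    · exact Ideal.span_mono (by simp)

/-- Let the plane curve `f` be smooth at `p`, and let `h` be singular at `p` and not divisible by
`f` there. In the local ring of `p`, modulo `f`, the equation `h` is a unit times
a power `m ≥ 2` of the coordinate `linForm c`. -/
theorem exists_relation {p c : Fin 3 → K} {f h : MvPolynomial (Fin 3) K} {e : ℕ}
    (hp : p ≠ 0) (hf : f.IsHomogeneous (e + 1)) (hfp : eval p f = 0)
    (hb : IsOrthogonalBasis p (fun i => eval p (pderiv i f)) c)
    (hh : lineEval p h = 0) (hdh : ∀ i, lineEval p (pderiv i h) = 0)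
    (hfh : ∀ s a, s * h = a * f → s ∈ pointIdeal p) :
    ∃ (m : ℕ) (s a u : MvPolynomial (Fin 3) K), 2 ≤ m ∧ s ∉ pointIdeal p ∧ u ∉ pointIdeal p ∧
      a ∈ pointIdeal p ∧ s * h = a * f + u * linForm c ^ m := by
  set l : Fin 3 → K := fun i => eval p (pderiv i f) with hl
  set ι := algebraMap (MvPolynomial (Fin 3) K) (PointLocalRing p)
  have hinj : Function.Injective ι := algebraMap_pointLocalRing_injective p
  have : IsNoetherianRing (PointLocalRing p) :=
    IsLocalization.isNoetherianRing (pointIdeal p).primeCompl _ inferInstance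
  have hhf : ι h ∉ Ideal.span {ι f} := by
    intro hmem
    obtain ⟨z, hz⟩ := Ideal.mem_span_singleton'.mp hmem
    obtain ⟨⟨a, s⟩, has⟩ := IsLocalization.surj (pointIdeal p).primeCompl z
    refine s.2 (hfh s a (hinj ?_))
    rw [map_mul, map_mul, ← hz, ← has]
    ring
  obtain ⟨m, u, hu, hmem⟩ := IsLocalRing.exists_sub_mul_pow_mem
    (maximalIdeal_pointLocalRing hp hf hfp hb) hhf
  obtain ⟨z, hz⟩ := Ideal.mem_span_singleton'.mp hmem
  obtain ⟨⟨a₁, s₁⟩, h₁⟩ := IsLocalization.surj (pointIdeal p).primeCompl z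
  obtain ⟨⟨a₂, s₂⟩, h₂⟩ := IsLocalization.surj (pointIdeal p).primeCompl u
  have hs₁ : (s₁ : MvPolynomial (Fin 3) K) ∉ pointIdeal p := s₁.2
  have hs₂ : (s₂ : MvPolynomial (Fin 3) K) ∉ pointIdeal p := s₂.2
  have ha₂ : a₂ ∉ pointIdeal p := by
    have : IsUnit (ι a₂) := by
      rw [← h₂]
      exact hu.mul (isUnit_algebraMap_pointLocalRing hs₂)
    exact (IsLocalization.AtPrime.isUnit_to_map_iff (PointLocalRing p) (pointIdeal p) a₂).mp this
  have hprime : ∀ {x y : MvPolynomial (Fin 3) K}, x ∉ pointIdeal p → y ∉ pointIdeal p →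
      x * y ∉ pointIdeal p := fun hx hy hxy =>
    (Ideal.IsPrime.mem_or_mem inferInstance hxy).elim hx hy
  have hrel : (s₁ * s₂ : MvPolynomial (Fin 3) K) * h =
      (a₁ * s₂) * f + (a₂ * s₁) * linForm c ^ m := by
    apply hinj
    simp only [map_add, map_mul, map_pow] at h₁ h₂ ⊢
    rw [← h₁, ← h₂]
    linear_combination -(ι s₁ * ι s₂) * hz
  set s := (s₁ * s₂ : MvPolynomial (Fin 3) K)
  set a := a₁ * (s₂ : MvPolynomial (Fin 3) K)
  have hs : s ∉ pointIdeal p := hprime hs₁ hs₂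
  have hw := hprime ha₂ hs₁
  set w := a₂ * (s₁ : MvPolynomial (Fin 3) K)
  have hεf : lineEval p f = 0 := by
    rw [lineEval_of_isHomogeneous p hf, hfp, map_zero, mul_zero]
  have hεc := lineEval_linForm p c hb.right
  have hC : ∀ x : K, lineEval p (C x) = Polynomial.C x := fun x => by simp [lineEval]
  have hdf : ∀ i, lineEval p (pderiv i f) = Polynomial.X ^ e * Polynomial.C (l i) := fun i =>
    lineEval_of_isHomogeneous p hf.pderiv
  have hXe : (Polynomial.X ^ e : Polynomial K) ≠ 0 := pow_ne_zero _ Polynomial.X_ne_zero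
  have hm0 : m ≠ 0 := by
    rintro rfl
    have h2 := congrArg (lineEval p) hrel
    simp only [map_add, map_mul, hh, hεf, pow_zero, mul_zero, zero_add, mul_one] at h2
    exact hw h2.symm
  -- the gradients of both sides along the line spanned by `p`
  have hgrad : ∀ i, lineEval p a * Polynomial.X ^ e * Polynomial.C (l i) +
      lineEval p w * ((m : Polynomial K) * (0 : Polynomial K) ^ (m - 1)) *
        Polynomial.C (c i) = 0 := by
    intro i
    have h1 := congrArg (fun q => lineEval p (pderiv i q)) hrel
    have hzero : lineEval p (pderiv i w) * (0 : Polynomial K) ^ m = 0 := by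
      rw [zero_pow hm0, mul_zero]
    simp only [map_add, pderiv_mul, pderiv_pow, map_mul, map_pow, map_natCast, pderiv_linForm,
      hh, hdh, hεf, hεc, hdf, hC, mul_zero, zero_add] at h1
    linear_combination -h1 - hzero
  have hind := hb.indep_polynomial hgrad
  have ha : a ∈ pointIdeal p := by
    rw [mem_pointIdeal]
    exact (mul_eq_zero.mp hind.1).resolve_right hXe
  refine ⟨m, s, a, w, ?_, hs, hw, ha, hrel⟩
  by_contra hm
  obtain rfl : m = 1 := by omega
  exact hw (mem_pointIdeal.mpr (by simpa using hind.2))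

end MonoidSurface

/-! ### Charts of projective space -/

namespace MonoidSurface

open MvPolynomial

variable {K : Type*} [Field K]

/-- The affine parametrization `y ↦ Q + Q_i (y with 0 inserted at i)` of the chart of index `i`
by coordinates centred at `Q`; it differs from the standard one by the factor `Q_i`. -/
noncomputable def chartMap (Q : Fin 4 → K) (i : Fin 4) :
    MvPolynomial (Fin 4) K →ₐ[K] MvPolynomial (Fin 3) K :=
  aeval fun k => C (Q k) + C (Q i) * i.insertNth (α := fun _ => MvPolynomial (Fin 3) K) 0 X k

theorem eval_zero_chartMap (Q : Fin 4 → K) (i : Fin 4) (q : MvPolynomial (Fin 4) K) :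
    eval 0 (chartMap Q i q) = eval Q q := by
  induction q using MvPolynomial.induction_on with
  | C a => simp [chartMap]
  | add q r hq hr => rw [map_add, map_add, hq, hr, map_add]
  | mul_X q k hq =>
    rw [map_mul, map_mul, hq, map_mul, eval_X]
    congr 1
    rw [chartMap, aeval_X]
    refine Fin.succAboveCases i ?_ (fun j => ?_) k <;> simp

theorem eval_zero_pderiv_chartMap (Q : Fin 4 → K) (i : Fin 4) (j : Fin 3)
    (q : MvPolynomial (Fin 4) K) :
    eval 0 (pderiv j (chartMap Q i q)) = Q i * eval Q (pderiv (i.succAbove j) q) := by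
  induction q using MvPolynomial.induction_on with
  | C a =>
    rw [show chartMap Q i (C a) = C a by simp [chartMap]]
    simp
  | add q r hq hr => simp only [map_add, hq, hr, mul_add]
  | mul_X q k hq =>
    have hX : eval 0 (pderiv j (chartMap Q i (X k))) =
        Q i * eval Q (pderiv (i.succAbove j) (X k)) := by
      rw [chartMap, aeval_X, map_add, pderiv_C, zero_add, pderiv_C_mul, map_mul, eval_C]
      congr 1
      refine Fin.succAboveCases i ?_ (fun l => ?_) k
      · rw [Fin.insertNth_apply_same, map_zero, map_zero, pderiv_X_of_ne (Fin.ne_succAbove i j),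
          map_zero]
      · rw [Fin.insertNth_apply_succAbove]
        by_cases h : l = j
        · subst h; simp
        · rw [pderiv_X_of_ne h, pderiv_X_of_ne (fun h' => h (Fin.succAbove_right_injective h'))]
          simp
    rw [map_mul, pderiv_mul, pderiv_mul, map_add, map_add, map_mul, map_mul, map_mul, map_mul, hq,
      hX, eval_zero_chartMap, eval_zero_chartMap]
    ring

/-- Three hypersurfaces through `Q` whose tangent spaces at `Q`, in the affine cone, meet only
along the line of `Q` are local coordinates of projective space at `Q`. -/
theorem isLocalCoordinates_chartMap {Q : Fin 4 → K} {i : Fin 4} (hQ : Q i ≠ 0)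
    {a : Fin 3 → MvPolynomial (Fin 4) K} (ha : ∀ k, eval Q (a k) = 0)
    (hV : ∀ V : Fin 4 → K, (∀ k, ∑ j, eval Q (pderiv j (a k)) * V j = 0) → ∃ μ : K, V = μ • Q) :
    IsLocalCoordinates fun k => chartMap Q i (a k) := by
  refine ⟨fun k => by rw [eval_zero_chartMap, ha], fun hdet => ?_⟩
  obtain ⟨v, hv, hMv⟩ := Matrix.exists_mulVec_eq_zero_iff.mpr hdet
  apply hv
  obtain ⟨μ, hμ⟩ := hV (i.insertNth (α := fun _ => K) 0 v) fun k => by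
    have h := congrFun hMv k
    simp only [Matrix.mulVec, dotProduct, Matrix.of_apply, eval_zero_pderiv_chartMap, mul_assoc,
      ← Finset.mul_sum, Pi.zero_apply] at h
    rw [Fin.sum_univ_succAbove _ i]
    simpa using (mul_eq_zero.mp h).resolve_left hQ
  have hμ0 : μ = 0 := by
    have h := congrFun hμ i
    rw [Fin.insertNth_apply_same, Pi.smul_apply, smul_eq_mul] at h
    exact (mul_eq_zero.mp h.symm).resolve_right hQ
  funext j
  have h := congrFun hμ (i.succAbove j)
  rw [Fin.insertNth_apply_succAbove, hμ0, zero_smul] at h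
  exact h

theorem chartMap_eq_localEquation {F : MvPolynomial (Fin 4) K} {d : ℕ} (hF : F.IsHomogeneous d)
    {P : ℙ K (Fin 4 → K)} {i : Fin 4} (hP : P.rep i ≠ 0) {ν : K} (hν : ν ≠ 0) :
    chartMap (ν • P.rep) i F = C ((ν * P.rep i) ^ d) * localEquation F P i := by
  rw [localEquation, map_pow, ← hF.aeval_mul_left, chartMap]
  congr 2
  funext k
  refine Fin.succAboveCases i ?_ (fun j => ?_) k
  · simp
  · simp only [Fin.insertNth_apply_succAbove, Pi.smul_apply, smul_eq_mul]
    rw [mul_add, ← C_mul, add_comm]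
    congr 2
    field_simp

theorem eval_rename_succ (Q : Fin 4 → K) (q : MvPolynomial (Fin 3) K) :
    eval Q (rename Fin.succ q) = eval (Fin.tail Q) q := by
  rw [eval_rename]; rfl

theorem sum_pderiv_rename_succ (Q V : Fin 4 → K) (q : MvPolynomial (Fin 3) K) :
    ∑ j, eval Q (pderiv j (rename Fin.succ q)) * V j =
      ∑ j, eval (Fin.tail Q) (pderiv j q) * Fin.tail V j := by
  rw [Fin.sum_univ_succ, pderiv_eq_zero_of_notMem_vars, map_zero, zero_mul, zero_add]
  · refine Finset.sum_congr rfl fun j _ => ?_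
    rw [pderiv_rename (Fin.succ_injective 3), eval_rename_succ]
    rfl
  · intro h
    obtain ⟨j, -, hj⟩ := Finset.mem_image.mp (vars_rename _ _ h)
    exact Fin.succ_ne_zero j hj

/-- Local coordinates of space at the point `Q = (κ t p_j : t p)`: the cone over the curve
`f`, smooth at `p`, the cone over a line transverse to it, and a surface through `Q` transverse to
the line joining `Q` to `O`. -/
theorem isLocalCoordinates_monoid {p c : Fin 3 → K} {f s α β : MvPolynomial (Fin 3) K} {e : ℕ}
    {t κ : K} {j : Fin 3} {i : Fin 4} {Q : Fin 4 → K}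
    (hp : p ≠ 0) (hf : f.IsHomogeneous (e + 1)) (hfp : eval p f = 0)
    (hb : IsOrthogonalBasis p (fun i => eval p (pderiv i f)) c) (ht : t ≠ 0)
    (hs : eval (t • p) s ≠ 0) (hQ0 : Q 0 = κ * Q j.succ) (hQ : Fin.tail Q = t • p)
    (hQi : Q i ≠ 0) :
    IsLocalCoordinates ![chartMap Q i (rename Fin.succ f),
      chartMap Q i (rename Fin.succ s * (X 0 - C κ * X j.succ) +
        rename Fin.succ (α * linForm (fun i => eval p (pderiv i f)) + β * linForm c)),
      chartMap Q i (rename Fin.succ (linForm c))] := by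
  set l : Fin 3 → K := fun i => eval p (pderiv i f) with hl
  have hscale : ∀ {q : MvPolynomial (Fin 3) K} {n : ℕ}, q.IsHomogeneous n →
      eval (t • p) q = t ^ n * eval p q := fun hq => hq.aeval_mul_left t p
  have hl0 : eval (t • p) (linForm l) = 0 := by
    rw [eval_linForm, dotProduct_smul, hb.left, smul_zero]
  have hc0 : eval (t • p) (linForm c) = 0 := by
    rw [eval_linForm, dotProduct_smul, hb.right, smul_zero]
  have hlin0 : Q 0 - κ * Q j.succ = 0 := sub_eq_zero.mpr hQ0
  have key := isLocalCoordinates_chartMap (i := i) (a := ![rename Fin.succ f,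
      rename Fin.succ s * (X 0 - C κ * X j.succ) +
        rename Fin.succ (α * linForm l + β * linForm c), rename Fin.succ (linForm c)]) hQi ?_ ?_
  · convert key using 1
    funext k
    fin_cases k <;> rfl
  · intro k
    fin_cases k
    · change eval Q (rename Fin.succ f) = 0
      rw [eval_rename_succ, hQ, hscale hf, hfp, mul_zero]
    · change eval Q (_ + _) = 0
      rw [map_add, map_mul, map_sub, map_mul, eval_X, eval_X, eval_C, hlin0, eval_rename_succ, hQ,
        eval_rename_succ, hQ, map_add, map_mul, map_mul, hl0, hc0]
      ring
    · change eval Q (rename Fin.succ (linForm c)) = 0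
      rw [eval_rename_succ, hQ, hc0]
  · intro V hV
    have h0 : ∑ j, eval Q (pderiv j (rename Fin.succ f)) * V j = 0 := hV 0
    have h1 : ∑ j', eval Q (pderiv j' (rename Fin.succ s * (X 0 - C κ * X j.succ) +
        rename Fin.succ (α * linForm l + β * linForm c))) * V j' = 0 := hV 1
    have h2 : ∑ j, eval Q (pderiv j (rename Fin.succ (linForm c))) * V j = 0 := hV 2
    rw [sum_pderiv_rename_succ, hQ] at h0 h2
    have hlV : l ⬝ᵥ Fin.tail V = 0 := by
      have : ∀ k, eval (t • p) (pderiv k f) = t ^ e * l k := fun k => hscale hf.pderiv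
      simp only [this, mul_assoc, ← Finset.mul_sum] at h0
      exact (mul_eq_zero.mp h0).resolve_left (pow_ne_zero _ ht)
    have hcV : c ⬝ᵥ Fin.tail V = 0 := by
      simpa [pderiv_linForm, dotProduct] using h2
    obtain ⟨μ, hμ⟩ := hb.exists_eq_smul hp hlV hcV
    have hV0 : V 0 = κ * V j.succ := by
      have h3 : ∀ k, eval Q (pderiv k (rename Fin.succ s * (X 0 - C κ * X j.succ) +
          rename Fin.succ (α * linForm l + β * linForm c))) * V k =
          eval (t • p) s * (eval Q (pderiv k (X 0 - C κ * X j.succ)) * V k) +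
          eval Q (pderiv k (rename Fin.succ (α * linForm l + β * linForm c))) * V k := by
        intro k
        rw [map_add, pderiv_mul, map_add, map_add, map_mul, map_mul, eval_rename_succ Q s, hQ,
          map_sub (eval Q), map_mul (eval Q) (C κ), eval_X, eval_X, eval_C, hlin0]
        ring
      have h4 : ∑ k, eval Q (pderiv k (rename Fin.succ (α * linForm l + β * linForm c))) * V k =
          0 := by
        rw [sum_pderiv_rename_succ, hQ]
        have h5 : ∀ k, eval (t • p) (pderiv k (α * linForm l + β * linForm c)) *
            Fin.tail V k = eval (t • p) α * (l k * Fin.tail V k) +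
              eval (t • p) β * (c k * Fin.tail V k) := by
          intro k
          simp only [map_add, pderiv_mul, map_mul, hl0, hc0, pderiv_linForm, eval_C]
          ring
        rw [Finset.sum_congr rfl fun k _ => h5 k, Finset.sum_add_distrib, ← Finset.mul_sum,
          ← Finset.mul_sum]
        change _ * (l ⬝ᵥ Fin.tail V) + _ * (c ⬝ᵥ Fin.tail V) = 0
        rw [hlV, hcV]
        ring
      have h6 : ∑ k, eval Q (pderiv k (X 0 - C κ * X j.succ)) * V k = V 0 - κ * V j.succ := by
        simp only [map_sub, pderiv_C_mul, pderiv_X, map_mul, eval_C, sub_mul,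
          Finset.sum_sub_distrib]
        rw [Finset.sum_eq_single 0 (fun k _ hk => by simp [hk.symm]) (by simp),
          Finset.sum_eq_single j.succ (fun k _ hk => by simp [hk.symm]) (by simp)]
        simp
      rw [Finset.sum_congr rfl fun k _ => h3 k, Finset.sum_add_distrib, ← Finset.mul_sum, h4, h6,
        add_zero] at h1
      exact sub_eq_zero.mp ((mul_eq_zero.mp h1).resolve_left hs)
    have hVs : ∀ k : Fin 3, V k.succ = μ * p k := fun k => congrFun hμ k
    have hQs : ∀ k : Fin 3, Q k.succ = t * p k := fun k => congrFun hQ k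
    refine ⟨μ / t, funext fun k => ?_⟩
    rw [Pi.smul_apply, smul_eq_mul]
    refine Fin.cases ?_ (fun k => ?_) k
    · rw [hV0, hQ0, hVs, hQs]
      field_simp
    · rw [hVs, hQs]
      field_simp

end MonoidSurface

/-! ### Intersection numbers and singularities of monoid surfaces -/

namespace MonoidSurface

open MvPolynomial

variable {K : Type*} [Field K]

theorem exists_eval_smul_ne_zero [Infinite K] {p : Fin 3 → K} {q : MvPolynomial (Fin 3) K}
    (hq : q ∉ pointIdeal p) : ∃ t : K, t ≠ 0 ∧ eval (t • p) q ≠ 0 := by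
  by_contra hcon
  push Not at hcon
  have h : Polynomial.X * lineEval p q = 0 := Polynomial.funext fun t => by
    rw [Polynomial.eval_mul, Polynomial.eval_X, eval_lineEval, Polynomial.eval_zero]
    by_cases ht : t = 0
    · rw [ht, zero_mul]
    · rw [hcon t ht, mul_zero]
  exact hq (mem_pointIdeal.mpr ((mul_eq_zero.mp h).resolve_left Polynomial.X_ne_zero))

theorem isHomogeneous_monoidForm {R : Type*} [CommRing R] {f g : MvPolynomial (Fin 3) R} {n : ℕ}
    (hf : f.IsHomogeneous n) (hg : g.IsHomogeneous (n + 1)) :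
    (monoidForm f g).IsHomogeneous (n + 1) := by
  refine IsHomogeneous.add ?_ hg.rename_isHomogeneous
  have h := (isHomogeneous_X R (0 : Fin 4)).mul (hf.rename_isHomogeneous (f := Fin.succ))
  rwa [Nat.add_comm 1 n] at h

theorem IsSingularPoint.monoidForm_vanishing {f g : MvPolynomial (Fin 3) K}
    {P : ℙ K (Fin 4 → K)} (hP : IsSingularPoint (monoidForm f g) P) :
    eval (Fin.tail P.rep) f = 0 ∧ eval (Fin.tail P.rep) g = 0 ∧
      ∀ k, P.rep 0 * eval (Fin.tail P.rep) (pderiv k f) +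
        eval (Fin.tail P.rep) (pderiv k g) = 0 := by
  have hnot : ∀ q : MvPolynomial (Fin 3) K, pderiv (0 : Fin 4) (rename Fin.succ q) = 0 := by
    intro q
    refine pderiv_eq_zero_of_notMem_vars fun h => ?_
    obtain ⟨j, -, hj⟩ := Finset.mem_image.mp (vars_rename _ _ h)
    exact Fin.succ_ne_zero j hj
  have h0 := hP.2 0
  rw [monoidForm, map_add, pderiv_mul, hnot, hnot, pderiv_X_self, one_mul, mul_zero, add_zero,
    add_zero, eval_rename_succ] at h0
  have h1 : eval P.rep (monoidForm f g) = 0 := hP.1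
  rw [monoidForm, map_add, map_mul, eval_rename_succ, h0, mul_zero, zero_add,
    eval_rename_succ] at h1
  refine ⟨h0, h1, fun k => ?_⟩
  have h2 := hP.2 k.succ
  rw [monoidForm, map_add, pderiv_mul, pderiv_X_of_ne (Fin.succ_ne_zero k).symm, zero_mul,
    zero_add, pderiv_rename (Fin.succ_injective 3), pderiv_rename (Fin.succ_injective 3), map_add,
    map_mul, eval_X, eval_rename_succ, eval_rename_succ] at h2
  exact h2

/-- If a power of `linForm c` lay in the ideal of the next one modulo `f`, the same would hold in
the local ring of projective space at a point over `p`, where both are local coordinates. -/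
theorem pow_linForm_notMem [Infinite K] {p c : Fin 3 → K} {f : MvPolynomial (Fin 3) K} {e : ℕ}
    (hp : p ≠ 0) (hf : f.IsHomogeneous (e + 1)) (hfp : eval p f = 0)
    (hb : IsOrthogonalBasis p (fun i => eval p (pderiv i f)) c) (n : ℕ) :
    algebraMap _ (PointLocalRing p) (linForm c) ^ n ∉
      Ideal.span {algebraMap _ (PointLocalRing p) f} ⊔
        Ideal.span {algebraMap _ (PointLocalRing p) (linForm c) ^ (n + 1)} := by
  intro hmem
  obtain ⟨_, h₁, _, h₂, hsum⟩ := Submodule.mem_sup.mp hmem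
  obtain ⟨x, rfl⟩ := Ideal.mem_span_singleton'.mp h₁
  obtain ⟨y, rfl⟩ := Ideal.mem_span_singleton'.mp h₂
  obtain ⟨⟨a₁, s₁⟩, h₁⟩ := IsLocalization.surj (pointIdeal p).primeCompl x
  obtain ⟨⟨a₂, s₂⟩, h₂⟩ := IsLocalization.surj (pointIdeal p).primeCompl y
  have hrel : (s₁ * s₂ : MvPolynomial (Fin 3) K) * linForm c ^ n =
      (a₁ * s₂) * f + (a₂ * s₁) * linForm c ^ (n + 1) := by
    apply algebraMap_pointLocalRing_injective p
    simp only [map_add, map_mul, map_pow] at h₁ h₂ ⊢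
    rw [← hsum, ← h₁, ← h₂]
    ring
  obtain ⟨t, ht, hst⟩ := exists_eval_smul_ne_zero (p := p)
    (q := (s₁ * s₂ : MvPolynomial (Fin 3) K)) fun h =>
      (Ideal.IsPrime.mem_or_mem inferInstance h).elim s₁.2 s₂.2
  obtain ⟨j, hj⟩ := Function.ne_iff.mp hp
  -- the point `(0 : p)` lies over `p`, and its representative keeps `s₁ s₂` from vanishing
  let Q : Fin 4 → K := Fin.cons 0 (t • p)
  have hcoord := isLocalCoordinates_monoid (s := 1) (α := 0) (β := 0) (κ := 0) (j := j)
    (i := j.succ) (Q := Q) hp hf hfp hb ht (by rw [map_one]; exact one_ne_zero) (by simp [Q]) rfl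
    (mul_ne_zero ht hj)
  refine hcoord.pow_notMem n ?_
  let ψ : MvPolynomial (Fin 3) K →+* OriginLocalRing K :=
    (algebraMap _ (OriginLocalRing K)).comp
      ((chartMap Q j.succ).toRingHom.comp (rename Fin.succ).toRingHom)
  have hu : IsUnit (ψ (s₁ * s₂)) := isUnit_algebraMap_of_eval_ne_zero (by
    change eval 0 (chartMap Q j.succ (rename Fin.succ _)) ≠ 0
    rw [eval_zero_chartMap, eval_rename_succ]
    exact hst)
  refine (Ideal.unit_mul_mem_iff_mem _ hu).mp ?_
  change ψ (s₁ * s₂) * ψ (linForm c) ^ n ∈ _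
  have hψ : ψ (s₁ * s₂) * ψ (linForm c) ^ n =
      ψ (a₁ * s₂) * ψ f + ψ (a₂ * s₁) * ψ (linForm c) ^ (n + 1) := by
    simpa only [map_add, map_mul, map_pow] using congrArg ψ hrel
  rw [hψ]
  exact add_mem (Ideal.mem_sup_left (Ideal.mul_mem_left _ _ (Ideal.subset_span (Or.inl rfl))))
    (Ideal.mem_sup_right (Ideal.mul_mem_left _ _ (Ideal.mem_span_singleton_self _)))

/-- The intersection number is the exponent `m` in a relation `s h = a f + u (linForm c)ᵐ`, where
`h` is congruent to `g` modulo `f`. -/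
theorem intersectionNumber_eq [Infinite K] {b : ℙ K (Fin 3 → K)} {c : Fin 3 → K}
    {f g r s a u : MvPolynomial (Fin 3) K} {e m : ℕ}
    (hf : f.IsHomogeneous (e + 1)) (hfp : eval b.rep f = 0)
    (hb : IsOrthogonalBasis b.rep (fun i => eval b.rep (pderiv i f)) c)
    (hs : s ∉ pointIdeal b.rep) (hu : u ∉ pointIdeal b.rep)
    (hrel : s * (g + r * f) = a * f + u * linForm c ^ m) :
    intersectionNumber b f g = m := by
  let ι := algebraMap (MvPolynomial (Fin 3) K) (PointLocalRing b.rep)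
  have hsu : IsUnit (ι s) := isUnit_algebraMap_pointLocalRing hs
  have huu : IsUnit (ι u) := isUnit_algebraMap_pointLocalRing hu
  have hι : ι s * (ι g + ι r * ι f) = ι a * ι f + ι u * ι (linForm c) ^ m := by
    simpa only [map_add, map_mul, map_pow] using congrArg ι hrel
  have hJ : Ideal.span {ι f, ι g} = Ideal.span {ι f} ⊔ Ideal.span {ι (linForm c) ^ m} := by
    have hf1 : ι f ∈ Ideal.span {ι f, ι g} := Ideal.subset_span (Or.inl rfl)
    have hg1 : ι g ∈ Ideal.span {ι f, ι g} := Ideal.subset_span (Or.inr rfl)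
    have hf2 : ι f ∈ Ideal.span {ι f} ⊔ Ideal.span {ι (linForm c) ^ m} :=
      Ideal.mem_sup_left (Ideal.mem_span_singleton_self _)
    have hc2 : ι (linForm c) ^ m ∈ Ideal.span {ι f} ⊔ Ideal.span {ι (linForm c) ^ m} :=
      Ideal.mem_sup_right (Ideal.mem_span_singleton_self _)
    apply le_antisymm
    · rw [Ideal.span_le]
      rintro _ (rfl | rfl)
      · exact hf2
      · refine (Ideal.unit_mul_mem_iff_mem _ hsu).mp ?_
        have : ι s * ι g = (ι a - ι s * ι r) * ι f + ι u * ι (linForm c) ^ m := by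
          linear_combination hι
        rw [this]
        exact add_mem (Ideal.mul_mem_left _ _ hf2) (Ideal.mul_mem_left _ _ hc2)
    · refine sup_le ?_ ?_
      · rw [Ideal.span_le, Set.singleton_subset_iff]
        exact hf1
      · rw [Ideal.span_le, Set.singleton_subset_iff]
        refine (Ideal.unit_mul_mem_iff_mem _ huu).mp ?_
        have : ι u * ι (linForm c) ^ m = (ι s * ι r - ι a) * ι f + ι s * ι g := by
          linear_combination -hι
        rw [this]
        exact add_mem (Ideal.mul_mem_left _ _ hf1) (Ideal.mul_mem_left _ _ hg1)
  have h1 : Module.length (PointLocalRing b.rep)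
      (PointLocalRing b.rep ⧸ IsLocalRing.maximalIdeal (PointLocalRing b.rep)) = 1 := by
    rw [Module.length_eq_one_iff, isSimpleModule_iff_isCoatom]
    exact (IsLocalRing.maximalIdeal.isMaximal _).out
  have hlen := IsLocalRing.length_quotient_sup_span_pow (PointLocalRing b.rep) h1
    (Ideal.span {ι f}) (ι (linForm c))
    (maximalIdeal_pointLocalRing b.rep_nonzero hf hfp hb)
    (pow_linForm_notMem b.rep_nonzero hf hfp hb) m
  rw [← hJ, Module.length_eq_of_surjective (R := PointLocalRing b.rep ⧸ Ideal.span {ι f, ι g})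
    Ideal.Quotient.mk_surjective] at hlen
  exact hlen

/-- The type of the singular point `P` of a monoid surface over an algebraically closed field,
where `P` lies on the line joining `O` to the point `b` of the plane. Coprimality enters in the
form `hfg`. -/
theorem exists_isASingularity [CharZero K] [IsAlgClosed K] {b : ℙ K (Fin 3 → K)}
    {P : ℙ K (Fin 4 → K)} {f g : MvPolynomial (Fin 3) K} {e : ℕ} {τ : K}
    (hf : f.IsHomogeneous (e + 1)) (hg : g.IsHomogeneous (e + 2))
    (hfg : ∀ s a, s * g = a * f → f ∣ s)
    (hτ : τ ≠ 0) (hPb : Fin.tail P.rep = τ • b.rep)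
    (hP : IsSingularPoint (monoidForm f g) P)
    (hsmooth : (fun i => eval b.rep (pderiv i f)) ≠ 0) :
    ∃ m : ℕ, 2 ≤ m ∧ intersectionNumber b f g = m ∧
      IsASingularity (m - 1) (monoidForm f g) P ∧
      HasMilnorNumber (monoidForm f g) P ((m - 1 : ℕ) : ℕ∞) := by
  set p := b.rep with hpdef
  have hp : p ≠ 0 := b.rep_nonzero
  set l : Fin 3 → K := fun i => eval p (pderiv i f) with hl
  obtain ⟨hPf, hPg, hPd⟩ := hP.monoidForm_vanishing
  rw [hPb] at hPf hPg hPd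
  have hscale : ∀ {q : MvPolynomial (Fin 3) K} {n : ℕ}, q.IsHomogeneous n →
      eval (τ • p) q = 0 → eval p q = 0 := fun {q n} hq h => by
    have h1 : eval (τ • p) q = τ ^ n * eval p q := hq.aeval_mul_left τ p
    rw [h1] at h
    exact (mul_eq_zero.mp h).resolve_left (pow_ne_zero _ hτ)
  have hfp : eval p f = 0 := hscale hf hPf
  obtain ⟨j, hj⟩ := Function.ne_iff.mp hp
  replace hj : p j ≠ 0 := hj
  have hPs : ∀ k : Fin 3, P.rep k.succ = τ * p k := fun k => congrFun hPb k
  -- `F = (x₀ - κ xⱼ) f + h` with `x₀ - κ xⱼ` vanishing at `P`, so that `h` is singular at `p`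
  set κ : K := P.rep 0 / P.rep j.succ with hκ
  have hκP : P.rep 0 = κ * P.rep j.succ := by
    rw [hκ, div_mul_cancel₀ _ (by rw [hPs]; exact mul_ne_zero hτ hj)]
  set r : MvPolynomial (Fin 3) K := C κ * X j with hr
  set h := g + r * f with hh
  have hhom : h.IsHomogeneous (e + 2) := by
    refine hg.add ?_
    have := (isHomogeneous_C_mul_X κ j).mul hf
    rwa [show 1 + (e + 1) = e + 2 by omega] at this
  have hεh : lineEval p h = 0 := by
    rw [lineEval_of_isHomogeneous p hhom, hscale hhom, map_zero, mul_zero]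
    rw [hh, map_add, map_mul, hPf, hPg, mul_zero, add_zero]
  have hεdh : ∀ i, lineEval p (pderiv i h) = 0 := by
    intro i
    rw [lineEval_of_isHomogeneous p (hhom.pderiv (i := i)), hscale hhom.pderiv, map_zero, mul_zero]
    have hrP : eval (τ • p) r = P.rep 0 := by
      rw [hκP, hPs]; simp [hr]
    simp only [hh, map_add, pderiv_mul, map_mul, hPf, hrP]
    linear_combination hPd i
  have hfmem : f ∈ pointIdeal p := by
    rw [mem_pointIdeal, lineEval_of_isHomogeneous p hf, hfp, map_zero, mul_zero]
  have hlp : l ⬝ᵥ p = 0 := by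
    have hE := congrArg (eval p) hf.sum_X_mul_pderiv
    simp only [map_sum, map_mul, eval_X, map_nsmul, hfp, smul_zero] at hE
    rw [← hE, dotProduct]
    exact Finset.sum_congr rfl fun k _ => mul_comm _ _
  obtain ⟨c, hb⟩ := exists_isOrthogonalBasis hp hsmooth hlp
  obtain ⟨m, s, a, u, hm, hs, hu, ha, hrel⟩ := exists_relation hp hf hfp hb hεh hεdh
    (fun s a hsa => by
      have h1 : s * g = (a - s * r) * f := by rw [hh] at hsa; linear_combination hsa
      exact Ideal.mem_of_dvd _ (hfg _ _ h1) hfmem)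
  obtain ⟨α, β, rfl⟩ := Ideal.mem_span_pair.mp (hb.pointIdeal_eq hp ▸ ha)
  -- the polynomials `s` and `u` need not be homogeneous, so the representative `t p` matters
  obtain ⟨t, ht, htsu⟩ := exists_eval_smul_ne_zero (p := p) (q := s * u) fun hsu =>
    (Ideal.IsPrime.mem_or_mem inferInstance hsu).elim hs hu
  rw [map_mul] at htsu
  have hts := left_ne_zero_of_mul htsu
  have htu := right_ne_zero_of_mul htsu
  set ν : K := t / τ with hν
  have hν0 : ν ≠ 0 := div_ne_zero ht hτ
  have hQtail : Fin.tail (ν • P.rep) = t • p := by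
    funext k
    change ν * P.rep k.succ = t * p k
    rw [hPs, hν]
    field_simp
  have hFhom := isHomogeneous_monoidForm hf hg
  have hm0 : m ≠ 0 := by omega
  -- the equation of the surface in each chart, in terms of local coordinates
  have hchart : ∀ i, P.rep i ≠ 0 → ∃ A B D v w : MvPolynomial (Fin 3) K,
      v * localEquation (monoidForm f g) P i = A * B + w * D ^ m ∧
      IsLocalCoordinates ![A, B, D] ∧ eval 0 v ≠ 0 ∧ eval 0 w ≠ 0 := by
    intro i hi
    refine ⟨_, _, _, chartMap (ν • P.rep) i (rename Fin.succ s) *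
      C ((ν * P.rep i) ^ (e + 1 + 1)), chartMap (ν • P.rep) i (rename Fin.succ u), ?_,
      isLocalCoordinates_monoid (i := i) (Q := ν • P.rep) (α := α) (β := β) (κ := κ) (j := j)
        hp hf hfp hb ht hts ?_ hQtail (mul_ne_zero hν0 hi), ?_, ?_⟩
    · rw [mul_assoc, ← chartMap_eq_localEquation hFhom hi hν0, ← map_mul, ← map_mul, ← map_pow,
        ← map_mul, ← map_add]
      congr 1
      have h1 := congrArg (rename (Fin.succ : Fin 3 → Fin 4)) hrel
      simp only [hh, hr, map_add, map_mul, map_pow, rename_X, rename_C] at h1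
      simp only [monoidForm, map_add, map_mul]
      linear_combination h1
    · change ν * P.rep 0 = κ * (ν * P.rep j.succ)
      rw [hκP]; ring
    · rw [map_mul, eval_C, eval_zero_chartMap, eval_rename_succ, hQtail]
      exact mul_ne_zero hts (pow_ne_zero _ (mul_ne_zero hν0 hi))
    · rw [eval_zero_chartMap, eval_rename_succ, hQtail]
      exact htu
  refine ⟨m, hm, intersectionNumber_eq hf hfp hb hs hu hrel, fun i hi => ?_, fun i hi => ?_⟩
  · obtain ⟨A, B, D, v, w, hG, hcoord, hv, hw⟩ := hchart i hi
    refine rightEquivalent_normalFormA (A := A) (B := B) (C := D) (v := v) (w := w) hm0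
      (by exact_mod_cast congrArg (fun q : MvPolynomial (Fin 3) K =>
        (q : MvPowerSeries (Fin 3) K)) hG) ?_ ?_ ?_ ?_ ?_ ?_
    · rw [constantCoeff_coe]; exact hcoord.eval_zero 0
    · rw [constantCoeff_coe]; exact hcoord.eval_zero 1
    · rw [constantCoeff_coe]; exact hcoord.eval_zero 2
    · rwa [constantCoeff_coe]
    · rwa [constantCoeff_coe]
    · convert hcoord.det_ne_zero using 2
      ext i j
      rw [Matrix.of_apply, Matrix.of_apply, ← coeff_single_one_coe]
      fin_cases i <;> rfl
  · obtain ⟨A, B, D, v, w, hG, hcoord, hv, hw⟩ := hchart i hi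
    exact milnorNumber_eq_sub_one hm0 hG hcoord hv hw

end MonoidSurface

theorem mainTheorem1 {k K : Type*} [Field k] [CharZero k] [Field K] [Algebra k K]
    [IsAlgClosure k K] (d : ℕ) (f g : MvPolynomial (Fin 3) k)
    (hfg : MonoidSurface.IsNormalizedNondegenerate K d f g)
    (P : ℙ K (Fin 4 → K)) (hPO : P ≠ MonoidSurface.pointO K)
    (hP : MonoidSurface.IsSingularPoint
      (MvPolynomial.map (algebraMap k K) (MonoidSurface.monoidForm f g)) P) :
    (∃ b : ℙ K (Fin 3 → K),
      MonoidSurface.IsZero (MvPolynomial.map (algebraMap k K) f) b ∧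
      MonoidSurface.IsZero (MvPolynomial.map (algebraMap k K) g) b ∧
      P ∈ MonoidSurface.line b) ∧
    ∀ b : ℙ K (Fin 3 → K), P ∈ MonoidSurface.line b →
      ∃ m : ℕ, 2 ≤ m ∧
        MonoidSurface.intersectionNumber b (MvPolynomial.map (algebraMap k K) f)
          (MvPolynomial.map (algebraMap k K) g) = m ∧
        MonoidSurface.IsASingularity (m - 1)
          (MvPolynomial.map (algebraMap k K) (MonoidSurface.monoidForm f g)) P ∧
        MonoidSurface.HasMilnorNumber
          (MvPolynomial.map (algebraMap k K) (MonoidSurface.monoidForm f g)) P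
          ((m - 1 : ℕ) : ℕ∞) := by
  have : CharZero K := charZero_of_injective_algebraMap (algebraMap k K).injective
  have : IsAlgClosed K := IsAlgClosure.isAlgClosed k
  obtain ⟨e, rfl⟩ : ∃ e, d = e + 2 := ⟨d - 2, by have := hfg.three_le; omega⟩
  have hmap : MvPolynomial.map (algebraMap k K) (MonoidSurface.monoidForm f g) =
      MonoidSurface.monoidForm (MvPolynomial.map (algebraMap k K) f)
        (MvPolynomial.map (algebraMap k K) g) := by
    simp [MonoidSurface.monoidForm, MvPolynomial.map_rename]
  rw [hmap] at hP ⊢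
  have hf : (MvPolynomial.map (algebraMap k K) f).IsHomogeneous (e + 1) :=
    hfg.isHomogeneous_left.map _
  have hg : (MvPolynomial.map (algebraMap k K) g).IsHomogeneous (e + 2) :=
    hfg.isHomogeneous_right.map _
  have hsing := hfg.no_common_singular_point
  have hdvd := fun s a => MvPolynomial.map_dvd_of_mul_map_eq (K := K) (s := s) (a := a)
    hfg.isRelPrime
  generalize MvPolynomial.map (algebraMap k K) f = f' at *
  generalize MvPolynomial.map (algebraMap k K) g = g' at *
  obtain ⟨hPf, hPg, hPd⟩ := hP.monoidForm_vanishing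
  -- a form vanishes at one nonzero multiple of a vector if and only if it does at any other
  have hscale : ∀ {q : MvPolynomial (Fin 3) K} {n : ℕ} {x : Fin 3 → K} {τ : K}, τ ≠ 0 →
      q.IsHomogeneous n → MvPolynomial.eval (τ • x) q = 0 → MvPolynomial.eval x q = 0 := by
    intro q n x τ hτ hq h
    have h1 : MvPolynomial.eval (τ • x) q = τ ^ n * MvPolynomial.eval x q :=
      hq.aeval_mul_left τ x
    rw [h1] at h
    exact (mul_eq_zero.mp h).resolve_left (pow_ne_zero _ hτ)
  have htail : Fin.tail P.rep ≠ 0 := by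
    intro h0
    apply hPO
    have hne : P.rep 0 ≠ 0 := by
      intro h00
      exact P.rep_nonzero (by rw [← Fin.cons_self_tail P.rep, h00, h0]; exact Matrix.cons_zero_zero)
    rw [← P.mk_rep, MonoidSurface.pointO, Projectivization.mk_eq_mk_iff']
    refine ⟨P.rep 0, ?_⟩
    funext i
    refine Fin.cases ?_ (fun i => ?_) i
    · simp
    · simp only [Pi.smul_apply, Pi.single_eq_of_ne (Fin.succ_ne_zero i), smul_zero]
      exact (congrFun h0 i).symm
  refine ⟨⟨Projectivization.mk K (Fin.tail P.rep) htail, ?_⟩, fun b hPb => ?_⟩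
  · set b := Projectivization.mk K (Fin.tail P.rep) htail with hb
    obtain ⟨τ, hτ⟩ := Projectivization.exists_smul_eq_mk_rep K (Fin.tail P.rep) htail
    have hτ' : Fin.tail P.rep = ((τ⁻¹ : Kˣ) : K) • b.rep := by
      rw [← hτ, ← Units.smul_def, inv_smul_smul]
    refine ⟨?_, ?_, ?_⟩
    · exact hscale (τ := ((τ⁻¹ : Kˣ) : K)) (Units.ne_zero _) hf (hτ' ▸ hPf)
    · exact hscale (τ := ((τ⁻¹ : Kˣ) : K)) (Units.ne_zero _) hg (hτ' ▸ hPg)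
    · have hcons : (Fin.cons (P.rep 0) (((τ⁻¹ : Kˣ) : K) • b.rep) : Fin 4 → K) = P.rep := by
        rw [← hτ', Fin.cons_self_tail]
      refine ⟨P.rep 0, ((τ⁻¹ : Kˣ) : K), by rw [hcons]; exact P.rep_nonzero, ?_⟩
      simp only [hcons]
      exact P.mk_rep.symm
  · obtain ⟨σ, t, hne, hPe⟩ := hPb
    obtain ⟨μ, hμ⟩ := Projectivization.exists_smul_eq_mk_rep K _ hne
    rw [← hPe, Units.smul_def] at hμ
    have hPt : Fin.tail P.rep = ((μ : K) * t) • b.rep := by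
      funext i
      have := congrFun hμ i.succ
      simp only [Pi.smul_apply, Fin.cons_succ, smul_eq_mul] at this
      simp only [Fin.tail, ← this, Pi.smul_apply, smul_eq_mul, mul_assoc]
    have hτ : (μ : K) * t ≠ 0 := by
      intro h0
      rw [h0, zero_smul] at hPt
      exact htail hPt
    refine MonoidSurface.exists_isASingularity hf hg hdvd hτ hPt hP fun h0 => hsing b ?_
    have hdf : ∀ i, MvPolynomial.eval b.rep (MvPolynomial.pderiv i f') = 0 := congrFun h0
    rw [hPt] at hPf hPg hPd
    refine ⟨⟨hscale hτ hf hPf, hdf⟩, hscale hτ hg hPg, fun i => hscale hτ hg.pderiv ?_⟩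
    have h1 : MvPolynomial.eval (((μ : K) * t) • b.rep) (MvPolynomial.pderiv i f') = _ :=
      hf.pderiv.aeval_mul_left _ _
    have h2 := hPd i
    change _ = _ * MvPolynomial.eval b.rep (MvPolynomial.pderiv i f') at h1
    rwa [h1, hdf, mul_zero, mul_zero, zero_add] at h2
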